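/- **Theorem.** Let $\mathbf{k}$ be a field of characteristic zero, let $E_1,E_2$ be finite-dimensional vector spaces, and let $\mathscr{P}=\mathscr{T}(E)/\langle R\rangle$ be a unary binary quadratic nonsymmetric (ns) operad: $\mathscr{T}(E)$ is the free ns operad (decorated planar trees) on $E=(0,E_1,E_2,0,\dots)$, and $R=R_1\sqcup R_2\sqcup R_3$ is an arity graded subspace of its part $\mathscr{T}(E)^{(2)}$ spanned by trees with two vertices, i.e. $$R_1\subseteq E_1\otimes E_1,\qquad R_2\subseteq (E_1\otimes E_2)\oplus (E_2\otimes E_1)\oplus (E_2\otimes E_1),\qquad R_3\subseteq (E_2\otimes E_2)\oplus (E_2\otimes E_2),$$ where, for $\alpha,\beta\in E_1$ and $\mu,\nu\in E_2$, the summands are spanned respectively by $\alpha\circ_1\beta$; by $\alpha\circ_1\mu$, $\mu\circ_1\alpha$, $\mu\circ_2\alpha$; and by $\mu\circ_1\nu$, $\mu\circ_2\nu$. Work with ns operads and cooperads in graded vector spaces, with the Koszul sign rule, and let $s$ be the suspension (of degree $1$). The *Koszul dual cooperad* of $\mathscr{P}$ is $\mathscr{P}^{¡}=\mathscr{C}(sE,s^2R)$,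 the largest sub-cooperad $\mathscr{C}$ of the cofree cooperad $\mathscr{T}^c(sE)$ for which the composite $\mathscr{C}\to\mathscr{T}^c(sE)\to\mathscr{T}^c(sE)^{(2)}/s^2R$ is zero. Let $\mathscr{S}^c$ be the suspension cooperad, $\mathscr{S}^c_n=\mathrm{Hom}((s\mathbf{k})^{\otimes n},s\mathbf{k})$, whose decomposition maps are inverse to the partial compositions of endomorphisms of $s\mathbf{k}$. The *Koszul dual operad* of $\mathscr{P}$ is the graded linear dual of the Hadamard (arity-wise tensor) product, $$\mathscr{P}^!=\big(\mathscr{S}^c\underset{\mathrm H}{\otimes}\mathscr{P}^{¡}\big)^*,$$ the dual of a component of degree $d$ being placed in degree $-d$. Let $E^*=(0,E_1^*,E_2^*,0,\dots)$ be the dual of the cogenerators $\mathscr{S}^c\otimes_{\mathrm H}sE$, so that $E_1^*$ has degree $-1$ and $E_2^*$ has degree $0$. Let $R^\perp=(R_1^\perp,R_2^\perp,R_3^\perp)$, where $R_i^\perp\subseteq\mathscr{T}(E^*)^{(2)}_i$ is the subspace orthogonal to $R_i$ for the bilinear form $\langle -,-\rangle_i:\mathscr{T}(E^*)^{(2)}_i\otimes\mathscr{T}(E)^{(2)}_i\to\mathbf{k}$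 given by $$\langle\alpha^*\circ_1\beta^*,\alpha\circ_1\beta\rangle_1=\alpha^*(\alpha)\beta^*(\beta),$$ $$\langle\alpha^*\circ_1\mu^*,\alpha\circ_1\mu\rangle_2=-\alpha^*(\alpha)\mu^*(\mu),\quad \langle\mu^*\circ_1\alpha^*,\mu\circ_1\alpha\rangle_2=\mu^*(\mu)\alpha^*(\alpha),\quad \langle\mu^*\circ_2\alpha^*,\mu\circ_2\alpha\rangle_2=\mu^*(\mu)\alpha^*(\alpha),$$ $$\langle\mu^*\circ_1\nu^*,\mu\circ_1\nu\rangle_3=\mu^*(\mu)\nu^*(\nu),\quad \langle\mu^*\circ_2\nu^*,\mu\circ_2\nu\rangle_3=-\mu^*(\mu)\nu^*(\nu),$$ and by zero on all other pairs of such trees. Then $$\mathscr{P}^!\;\cong\;\mathscr{T}(E^*)/\langle R^\perp\rangle$$ as graded ns operads, by an isomorphism that is the identity on the generators $E^*$. -/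

import Mathlib

open scoped TensorProduct DirectSum

universe u

noncomputable section

namespace UnaryBinary

/-! ## Signs and planar trees -/

/-- The sign `(-1)^z` as an element of `k`. -/
def sgn (k : Type u) [Field k] (z : ℤ) : k := ((Int.negOnePow z : ℤ) : k)

/-- Shapes of reduced planar rooted trees all of whose internal vertices have one or two inputs.
`leaf` is the tree without internal vertex. -/
inductive Shape : Type
  | leaf : Shape
  | un (t : Shape) : Shape
  | bin (l r : Shape) : Shape

instance : DecidableEq Shape := Classical.decEq _

/-- Number of leaves. -/
def Shape.arity : Shape → ℕ
  | .leaf => 1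
  | .un t => t.arity
  | .bin l r => l.arity + r.arity

/-- Total degree if each unary vertex has degree `a₁` and each binary vertex has degree `a₂`. -/
def Shape.degree (a₁ a₂ : ℤ) : Shape → ℤ
  | .leaf => 0
  | .un t => a₁ + t.degree a₁ a₂
  | .bin l r => a₂ + (l.degree a₁ a₂ + r.degree a₁ a₂)

section Trees

variable (k : Type u) [Field k]
variable (E₁ E₂ : Type u) [AddCommGroup E₁] [Module k E₁] [AddCommGroup E₂] [Module k E₂]

/-- The vector space of decorations of a shape: the tensor product, over the internal vertices
in planar (depth first, root first, left to right) order, of one copy of `E₁` for each unary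
vertex and one copy of `E₂` for each binary vertex. -/
def Dec : Shape → ModuleCat.{u} k
  | .leaf => ModuleCat.of k k
  | .un t => ModuleCat.of k (E₁ ⊗[k] Dec t)
  | .bin l r => ModuleCat.of k (E₂ ⊗[k] (Dec l ⊗[k] Dec r))

/-- The decorations of the tree without internal vertex are scalars. -/
def decLeaf : Dec k E₁ E₂ .leaf ≃ₗ[k] k := LinearEquiv.refl k k

/-- The root vertex of a tree whose root is unary, and the rest of the tree. -/
def decUn (t : Shape) : Dec k E₁ E₂ (.un t) ≃ₗ[k] E₁ ⊗[k] Dec k E₁ E₂ t :=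
  LinearEquiv.refl k (E₁ ⊗[k] Dec k E₁ E₂ t)

/-- The root vertex of a tree whose root is binary, and the rest of the tree. -/
def decBin (l r : Shape) :
    Dec k E₁ E₂ (.bin l r) ≃ₗ[k] E₂ ⊗[k] (Dec k E₁ E₂ l ⊗[k] Dec k E₁ E₂ r) :=
  LinearEquiv.refl k (E₂ ⊗[k] (Dec k E₁ E₂ l ⊗[k] Dec k E₁ E₂ r))

/-- The space `𝒯(E)` of all trees decorated by `E = (0, E₁, E₂, 0, …)`, all arities together. -/
abbrev Tree : Type u := ⨁ s : Shape, Dec k E₁ E₂ s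

variable {E₁ E₂}

/-- The decorated trees of a given shape, as elements of `𝒯(E)`. -/
abbrev ofShape (s : Shape) : Dec k E₁ E₂ s →ₗ[k] Tree k E₁ E₂ :=
  DirectSum.lof k Shape (fun s => Dec k E₁ E₂ s) s

/-- The tree without internal vertex (the operadic identity). -/
def leafT : Tree k E₁ E₂ := ofShape k .leaf ((decLeaf k E₁ E₂).symm 1)

/-- `unT v X`: the tree with root vertex decorated by `v ∈ E₁`, carrying `X`. -/
def unT : E₁ →ₗ[k] Tree k E₁ E₂ →ₗ[k] Tree k E₁ E₂ :=
  LinearMap.flip <| DirectSum.toModule k Shape (E₁ →ₗ[k] Tree k E₁ E₂) fun t =>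
    ((TensorProduct.mk k E₁ (Dec k E₁ E₂ t)).compr₂ 
      (ofShape k (.un t) ∘ₗ (decUn k E₁ E₂ t).symm.toLinearMap)).flip

/-- `binT v X Y`: the tree with root vertex decorated by `v ∈ E₂`, carrying `X` on the left input
and `Y` on the right input. -/
def binT : E₂ →ₗ[k] Tree k E₁ E₂ →ₗ[k] Tree k E₁ E₂ →ₗ[k] Tree k E₁ E₂ :=
  let f (l r : Shape) : Dec k E₁ E₂ l →ₗ[k] Dec k E₁ E₂ r →ₗ[k] E₂ →ₗ[k] Tree k E₁ E₂ :=
    TensorProduct.curry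
      (((TensorProduct.mk k E₂ (Dec k E₁ E₂ l ⊗[k] Dec k E₁ E₂ r)).compr₂
        (ofShape k (.bin l r) ∘ₗ (decBin k E₁ E₂ l r).symm.toLinearMap)).flip)
  let g : Tree k E₁ E₂ →ₗ[k] Tree k E₁ E₂ →ₗ[k] E₂ →ₗ[k] Tree k E₁ E₂ :=
    DirectSum.toModule k Shape _ fun l =>
      (DirectSum.toModule k Shape _ fun r => (f l r).flip).flip
  (LinearMap.lflip.toLinearMap ∘ₗ g).flip

/-- The subspace of decorated trees of arity `n` and degree `d`, where the vertices decorated by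
`E₁` have degree `a₁` and those decorated by `E₂` have degree `a₂`. -/
def piece (a₁ a₂ : ℤ) (n : ℕ) (d : ℤ) : Submodule k (Tree k E₁ E₂) where
  carrier := {X | ∀ s : Shape, ¬(s.arity = n ∧ s.degree a₁ a₂ = d) → X s = 0}
  zero_mem' := fun _ _ => rfl
  add_mem' := fun {X Y} hX hY s hs => by
    rw [DirectSum.add_apply, hX s hs, hY s hs, add_zero]
  smul_mem' := fun c X hX s hs => by
    rw [DirectSum.smul_apply, hX s hs, smul_zero]

/-- The projection of `𝒯(E)` onto its component of arity `n` and degree `d`. -/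
def proj (a₁ a₂ : ℤ) (n : ℕ) (d : ℤ) :
    Tree k E₁ E₂ →ₗ[k] piece k (E₁ := E₁) (E₂ := E₂) a₁ a₂ n d :=
  LinearMap.codRestrict _
    (DFinsupp.filterLinearMap k (fun s => (Dec k E₁ E₂ s : Type u))
      (fun s => s.arity = n ∧ s.degree a₁ a₂ = d))
    (fun X s hs => by
      rw [DFinsupp.filterLinearMap_apply]
      exact (DFinsupp.filter_apply _ _ _).trans (if_neg hs))

/-- `unT` as a linear map on the tensor product. -/
def unU : E₁ ⊗[k] Tree k E₁ E₂ →ₗ[k] Tree k E₁ E₂ := TensorProduct.lift (unT k)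

/-- `binT` as a linear map on the tensor product. -/
def binU : E₂ ⊗[k] (Tree k E₁ E₂ ⊗[k] Tree k E₁ E₂) →ₗ[k] Tree k E₁ E₂ :=
  TensorProduct.lift
    ((TensorProduct.uncurry (RingHom.id k) (Tree k E₁ E₂) (Tree k E₁ E₂) (Tree k E₁ E₂)) ∘ₗ binT k)

/-- `v ⊗ f ↦ (Z ↦ unT v (f Z))`. -/
def unOp : E₁ ⊗[k] (Tree k E₁ E₂ →ₗ[k] Tree k E₁ E₂) →ₗ[k] Tree k E₁ E₂ →ₗ[k] Tree k E₁ E₂ :=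
  TensorProduct.lift
    (LinearMap.llcomp k (Tree k E₁ E₂) (Tree k E₁ E₂) (Tree k E₁ E₂) ∘ₗ unT k)

/-- `v ⊗ (f ⊗ Y) ↦ (Z ↦ binT v (f Z) Y)`. -/
def binOpL : E₂ ⊗[k] ((Tree k E₁ E₂ →ₗ[k] Tree k E₁ E₂) ⊗[k] Tree k E₁ E₂) →ₗ[k]
    Tree k E₁ E₂ →ₗ[k] Tree k E₁ E₂ :=
  TensorProduct.lift
    ((TensorProduct.uncurry (RingHom.id k) _ _ _) ∘ₗ LinearMap.lflip.toLinearMap ∘ₗ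
    (LinearMap.lflip.toLinearMap ∘ₗ binT k).compr₂
      (LinearMap.llcomp k (Tree k E₁ E₂) (Tree k E₁ E₂) (Tree k E₁ E₂)))

/-- `v ⊗ (X ⊗ f) ↦ (Z ↦ binT v X (f Z))`. -/
def binOpR : E₂ ⊗[k] (Tree k E₁ E₂ ⊗[k] (Tree k E₁ E₂ →ₗ[k] Tree k E₁ E₂)) →ₗ[k]
    Tree k E₁ E₂ →ₗ[k] Tree k E₁ E₂ :=
  TensorProduct.lift
    ((TensorProduct.uncurry (RingHom.id k) _ _ _) ∘ₗ
    (binT k).compr₂ (LinearMap.llcomp k (Tree k E₁ E₂) (Tree k E₁ E₂) (Tree k E₁ E₂)))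

/-- `graftS a₁ a₂ e s i X Y`: the tree `X` of shape `s` with the homogeneous element `Y` of
degree `e` grafted on its `i`-th leaf (`1 ≤ i ≤ arity of s`; zero otherwise). The Koszul sign is
that of moving the vertices of `Y` past the vertices of `X` that come after the `i`-th leaf. -/
def graftS (a₁ a₂ e : ℤ) :
    (s : Shape) → (i : ℕ) → Dec k E₁ E₂ s →ₗ[k] Tree k E₁ E₂ →ₗ[k] Tree k E₁ E₂
  | .leaf, i => if i = 1 then LinearMap.lsmul k (Tree k E₁ E₂) ∘ₗ (decLeaf k E₁ E₂).toLinearMap else 0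
  | .un t, i => unOp k ∘ₗ TensorProduct.map LinearMap.id (graftS a₁ a₂ e t i) ∘ₗ (decUn k E₁ E₂ t).toLinearMap
  | .bin l r, i =>
      if i ≤ l.arity then
        sgn k (r.degree a₁ a₂ * e) • (binOpL k ∘ₗ
          TensorProduct.map LinearMap.id (TensorProduct.map (graftS a₁ a₂ e l i) (ofShape k r)) ∘ₗ
          (decBin k E₁ E₂ l r).toLinearMap)
      else
        binOpR k ∘ₗ TensorProduct.map LinearMap.id
          (TensorProduct.map (ofShape k l) (graftS a₁ a₂ e r (i - l.arity))) ∘ₗ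
          (decBin k E₁ E₂ l r).toLinearMap

/-- Grafting `X ∘ᵢ Y` of a homogeneous element `Y` of degree `e` on the `i`-th leaf of `X`. -/
def graft (a₁ a₂ e : ℤ) (i : ℕ) : Tree k E₁ E₂ →ₗ[k] Tree k E₁ E₂ →ₗ[k] Tree k E₁ E₂ :=
  DirectSum.toModule k Shape _ fun s => graftS k a₁ a₂ e s i

/-- `v ⊗ (X ⊗ Z) ↦ unT v X ⊗ Z`. -/
def unCut : E₁ ⊗[k] (Tree k E₁ E₂ ⊗[k] Tree k E₁ E₂) →ₗ[k] Tree k E₁ E₂ ⊗[k] Tree k E₁ E₂ :=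
  TensorProduct.map (unU k) LinearMap.id ∘ₗ
    (TensorProduct.assoc k E₁ (Tree k E₁ E₂) (Tree k E₁ E₂)).symm.toLinearMap

/-- `v ⊗ (X ⊗ (Y ⊗ Z)) ↦ binT v X Y ⊗ Z`. -/
def binCutR : E₂ ⊗[k] (Tree k E₁ E₂ ⊗[k] (Tree k E₁ E₂ ⊗[k] Tree k E₁ E₂)) →ₗ[k]
    Tree k E₁ E₂ ⊗[k] Tree k E₁ E₂ :=
  TensorProduct.map (binU k) LinearMap.id ∘ₗ
    (TensorProduct.assoc k E₂ (Tree k E₁ E₂ ⊗[k] Tree k E₁ E₂) (Tree k E₁ E₂)).symm.toLinearMap ∘ₗ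
    TensorProduct.map LinearMap.id
      (TensorProduct.assoc k (Tree k E₁ E₂) (Tree k E₁ E₂) (Tree k E₁ E₂)).symm.toLinearMap

/-- `v ⊗ ((X ⊗ Z) ⊗ Y) ↦ binT v X Y ⊗ Z`. -/
def binCutL : E₂ ⊗[k] ((Tree k E₁ E₂ ⊗[k] Tree k E₁ E₂) ⊗[k] Tree k E₁ E₂) →ₗ[k]
    Tree k E₁ E₂ ⊗[k] Tree k E₁ E₂ :=
  TensorProduct.map (binU k) LinearMap.id ∘ₗ
    (TensorProduct.assoc k E₂ (Tree k E₁ E₂ ⊗[k] Tree k E₁ E₂) (Tree k E₁ E₂)).symm.toLinearMap ∘ₗ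
    TensorProduct.map LinearMap.id
      (TensorProduct.rightComm k (Tree k E₁ E₂) (Tree k E₁ E₂) (Tree k E₁ E₂)).toLinearMap

/-- The trivial cut `X ↦ id ⊗ X`, which writes `X` as `id ∘₁ X`. -/
def rootCut (s : Shape) (i : ℕ) : Dec k E₁ E₂ s →ₗ[k] Tree k E₁ E₂ ⊗[k] Tree k E₁ E₂ :=
  if i = 1 then TensorProduct.mk k (Tree k E₁ E₂) (Tree k E₁ E₂) (leafT k) ∘ₗ ofShape k s else 0

/-- `cutS a₁ a₂ e s i X` is the sum of `± X' ⊗ X''` over all ways of writing the tree `X` of shape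
`s` as a grafting `X' ∘ᵢ X''` (the trivial ones `X' = id` and `X'' = id` included), with the same
Koszul sign as in the grafting; `e` is the degree of the factors `X''` that one is interested in. -/
def cutS (a₁ a₂ e : ℤ) :
    (s : Shape) → (i : ℕ) → Dec k E₁ E₂ s →ₗ[k] Tree k E₁ E₂ ⊗[k] Tree k E₁ E₂
  | .leaf, i => rootCut k .leaf i
  | .un t, i =>
      rootCut k (.un t) i +
      unCut k ∘ₗ TensorProduct.map LinearMap.id (cutS a₁ a₂ e t i) ∘ₗ (decUn k E₁ E₂ t).toLinearMap
  | .bin l r, i =>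
      rootCut k (.bin l r) i +
      sgn k (r.degree a₁ a₂ * e) • (binCutL k ∘ₗ
        TensorProduct.map LinearMap.id (TensorProduct.map (cutS a₁ a₂ e l i) (ofShape k r)) ∘ₗ
          (decBin k E₁ E₂ l r).toLinearMap) +
      (if l.arity < i then
        binCutR k ∘ₗ TensorProduct.map LinearMap.id
          (TensorProduct.map (ofShape k l) (cutS a₁ a₂ e r (i - l.arity))) ∘ₗ
          (decBin k E₁ E₂ l r).toLinearMap
      else 0)

/-- `cutS` on all shapes together. -/
def cut (a₁ a₂ e : ℤ) (i : ℕ) : Tree k E₁ E₂ →ₗ[k] Tree k E₁ E₂ ⊗[k] Tree k E₁ E₂ :=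
  DirectSum.toModule k Shape _ fun s => cutS k a₁ a₂ e s i

end Trees

section Grafting

variable (k : Type u) [Field k]
variable {E₁ E₂ : Type u} [AddCommGroup E₁] [Module k E₁] [AddCommGroup E₂] [Module k E₂]

theorem sgn_zero : sgn k 0 = 1 := by simp [sgn]

theorem sgn_add (a b : ℤ) : sgn k (a + b) = sgn k a * sgn k b := by
  simp [sgn, Int.negOnePow_add]

theorem sgn_mul_self (a : ℤ) : sgn k a * sgn k a = 1 := by
  rw [← sgn_add, sgn, Int.negOnePow_even _ ⟨a, rfl⟩]; simp

theorem unT_ofShape (t : Shape) (v : E₁) (x : Dec k E₁ E₂ t) :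
    unT k v (ofShape k t x) = ofShape k (.un t) ((decUn k E₁ E₂ t).symm (v ⊗ₜ[k] x)) := by
  simp [unT, ofShape, DirectSum.toModule_lof]

theorem binT_ofShape (l r : Shape) (v : E₂) (x : Dec k E₁ E₂ l) (y : Dec k E₁ E₂ r) :
    binT k v (ofShape k l x) (ofShape k r y) =
      ofShape k (.bin l r) ((decBin k E₁ E₂ l r).symm (v ⊗ₜ[k] (x ⊗ₜ[k] y))) := by
  simp [binT, ofShape, DirectSum.toModule_lof]

theorem ofShape_leaf (c : Dec k E₁ E₂ .leaf) :
    ofShape k .leaf c = decLeaf k E₁ E₂ c • leafT k := by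
  rw [leafT, ← map_smul, ← map_smul, smul_eq_mul, mul_one, LinearEquiv.symm_apply_apply]

theorem graft_leafT (a₁ a₂ e : ℤ) (i : ℕ) (Z : Tree k E₁ E₂) :
    graft k a₁ a₂ e i (leafT k) Z = if i = 1 then Z else 0 := by
  simp only [graft, leafT, ofShape, DirectSum.toModule_lof]
  rw [graftS]
  split_ifs <;> simp

theorem graft_ofShape_un (a₁ a₂ e : ℤ) (i : ℕ) (t : Shape) (v : E₁) (x : Dec k E₁ E₂ t)
    (Z : Tree k E₁ E₂) :
    graft k a₁ a₂ e i (unT k v (ofShape k t x)) Z =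
      unT k v (graft k a₁ a₂ e i (ofShape k t x) Z) := by
  rw [unT_ofShape]
  simp only [graft, DirectSum.toModule_lof, ofShape]
  rw [graftS]
  simp [unOp]

theorem graft_ofShape_bin (a₁ a₂ e : ℤ) (i : ℕ) (l r : Shape) (v : E₂) (x : Dec k E₁ E₂ l)
    (y : Dec k E₁ E₂ r) (Z : Tree k E₁ E₂) :
    graft k a₁ a₂ e i (binT k v (ofShape k l x) (ofShape k r y)) Z =
      if i ≤ l.arity then
        sgn k (r.degree a₁ a₂ * e) •
          binT k v (graft k a₁ a₂ e i (ofShape k l x) Z) (ofShape k r y)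
      else binT k v (ofShape k l x) (graft k a₁ a₂ e (i - l.arity) (ofShape k r y) Z) := by
  rw [binT_ofShape]
  simp only [graft, DirectSum.toModule_lof, ofShape]
  rw [graftS]
  split_ifs <;> simp [binOpL, binOpR]

theorem ofShape_mem (a₁ a₂ : ℤ) (s : Shape) (x : Dec k E₁ E₂ s) :
    ofShape k s x ∈ piece k (E₁ := E₁) (E₂ := E₂) a₁ a₂ s.arity (s.degree a₁ a₂) := by
  intro t ht
  have h : t ≠ s := by rintro rfl; exact ht ⟨rfl, rfl⟩
  simp [ofShape, DirectSum.lof_eq_of, DirectSum.of_eq_of_ne, h]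

theorem leafT_mem (a₁ a₂ : ℤ) : leafT k ∈ piece k (E₁ := E₁) (E₂ := E₂) a₁ a₂ 1 0 :=
  ofShape_mem k a₁ a₂ .leaf _

variable {k}

theorem piece_induction {a₁ a₂ : ℤ} {n : ℕ} {d : ℤ} {p : Tree k E₁ E₂ → Prop} (h0 : p 0)
    (hadd : ∀ X Y, p X → p Y → p (X + Y))
    (hs : ∀ (s : Shape) (x : Dec k E₁ E₂ s), s.arity = n → s.degree a₁ a₂ = d →
      p (ofShape k s x)) {X : Tree k E₁ E₂} (hX : X ∈ piece k a₁ a₂ n d) : p X := by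
  classical
  rw [← DirectSum.sum_support_of X]
  refine Finset.sum_induction _ p hadd h0 fun s _ => ?_
  by_cases h : s.arity = n ∧ s.degree a₁ a₂ = d
  · exact hs s _ h.1 h.2
  · rw [hX s h, map_zero]; exact h0

theorem shape_induction {p : Shape → Tree k E₁ E₂ → Prop}
    (h0 : ∀ s, p s 0) (hadd : ∀ s X Y, p s X → p s Y → p s (X + Y))
    (hleaf : ∀ c : k, p .leaf (c • leafT k))
    (hun : ∀ t v (x : Dec k E₁ E₂ t), p t (ofShape k t x) → p (.un t) (unT k v (ofShape k t x)))
    (hbin : ∀ l r v (x : Dec k E₁ E₂ l) (y : Dec k E₁ E₂ r), p l (ofShape k l x) →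
      p r (ofShape k r y) → p (.bin l r) (binT k v (ofShape k l x) (ofShape k r y)))
    (s : Shape) (x : Dec k E₁ E₂ s) : p s (ofShape k s x) := by
  induction s with
  | leaf => rw [ofShape_leaf]; exact hleaf _
  | un t ih =>
    obtain ⟨w, rfl⟩ := (decUn k E₁ E₂ t).symm.surjective x
    induction w with
    | zero => rw [map_zero, map_zero]; exact h0 _
    | add a b ha hb => rw [map_add, map_add]; exact hadd _ _ _ ha hb
    | tmul v x => rw [← unT_ofShape]; exact hun t v x (ih x)
  | bin l r ihl ihr =>
    obtain ⟨w, rfl⟩ := (decBin k E₁ E₂ l r).symm.surjective x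
    induction w with
    | zero => rw [map_zero, map_zero]; exact h0 _
    | add a b ha hb => rw [map_add, map_add]; exact hadd _ _ _ ha hb
    | tmul v z =>
      induction z with
      | zero => rw [TensorProduct.tmul_zero, map_zero, map_zero]; exact h0 _
      | add a b ha hb => rw [TensorProduct.tmul_add, map_add, map_add]; exact hadd _ _ _ ha hb
      | tmul x y => rw [← binT_ofShape]; exact hbin l r v x y (ihl x) (ihr y)

theorem unT_mem {a₁ a₂ : ℤ} {n : ℕ} {d : ℤ} (v : E₁) {X : Tree k E₁ E₂}
    (hX : X ∈ piece k a₁ a₂ n d) : unT k v X ∈ piece k a₁ a₂ n (a₁ + d) := by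
  refine piece_induction (p := fun X => unT k v X ∈ piece k a₁ a₂ n (a₁ + d)) ?_ ?_ ?_ hX
  · rw [map_zero]; exact zero_mem _
  · intro X Y h h'; rw [map_add]; exact add_mem h h'
  · rintro s x rfl rfl
    rw [unT_ofShape]; exact ofShape_mem k a₁ a₂ (.un s) _

theorem binT_mem {a₁ a₂ : ℤ} {m n : ℕ} {d e : ℤ} (v : E₂) {X Y : Tree k E₁ E₂}
    (hX : X ∈ piece k a₁ a₂ m d) (hY : Y ∈ piece k a₁ a₂ n e) :
    binT k v X Y ∈ piece k a₁ a₂ (m + n) (a₂ + (d + e)) := by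
  refine piece_induction (p := fun X => binT k v X Y ∈ piece k a₁ a₂ (m + n) (a₂ + (d + e)))
    ?_ ?_ ?_ hX
  · rw [map_zero, LinearMap.zero_apply]; exact zero_mem _
  · intro X Y h h'; rw [map_add, LinearMap.add_apply]; exact add_mem h h'
  rintro s x rfl rfl
  refine piece_induction
    (p := fun Y => binT k v (ofShape k s x) Y ∈ piece k a₁ a₂ _ (a₂ + (s.degree a₁ a₂ + e)))
    ?_ ?_ ?_ hY
  · rw [map_zero]; exact zero_mem _
  · intro X Y h h'; rw [map_add]; exact add_mem h h'
  rintro t y rfl rfl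
  rw [binT_ofShape]; exact ofShape_mem k a₁ a₂ (.bin s t) _

theorem graft_unT {a₁ a₂ e : ℤ} {n : ℕ} {d : ℤ} (i : ℕ) (v : E₁) {X : Tree k E₁ E₂}
    (hX : X ∈ piece k a₁ a₂ n d) (Z : Tree k E₁ E₂) :
    graft k a₁ a₂ e i (unT k v X) Z = unT k v (graft k a₁ a₂ e i X Z) := by
  refine piece_induction
    (p := fun X => graft k a₁ a₂ e i (unT k v X) Z = unT k v (graft k a₁ a₂ e i X Z)) ?_ ?_ ?_ hX
  · simp
  · intro X Y h h'; simp only [map_add, LinearMap.add_apply, h, h']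
  · intro s x _ _; exact graft_ofShape_un k a₁ a₂ e i s v x Z

theorem graft_binT {a₁ a₂ e : ℤ} {m n : ℕ} {d δ : ℤ} (i : ℕ) (v : E₂) {X Y : Tree k E₁ E₂}
    (hX : X ∈ piece k a₁ a₂ m d) (hY : Y ∈ piece k a₁ a₂ n δ) (Z : Tree k E₁ E₂) :
    graft k a₁ a₂ e i (binT k v X Y) Z =
      if i ≤ m then sgn k (δ * e) • binT k v (graft k a₁ a₂ e i X Z) Y
      else binT k v X (graft k a₁ a₂ e (i - m) Y Z) := by
  refine piece_induction
    (p := fun X => graft k a₁ a₂ e i (binT k v X Y) Z =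
      if i ≤ m then sgn k (δ * e) • binT k v (graft k a₁ a₂ e i X Z) Y
      else binT k v X (graft k a₁ a₂ e (i - m) Y Z)) ?_ ?_ ?_ hX
  · simp
  · intro X X' h h'
    simp only [map_add, LinearMap.add_apply, h, h']
    split_ifs <;> simp
  rintro s x rfl rfl
  refine piece_induction
    (p := fun Y => graft k a₁ a₂ e i (binT k v (ofShape k s x) Y) Z =
      if i ≤ s.arity then sgn k (δ * e) • binT k v (graft k a₁ a₂ e i (ofShape k s x) Z) Y
      else binT k v (ofShape k s x) (graft k a₁ a₂ e (i - s.arity) Y Z)) ?_ ?_ ?_ hY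
  · simp
  · intro X X' h h'
    simp only [map_add, LinearMap.add_apply, h, h']
    split_ifs <;> simp
  rintro t y rfl rfl
  exact graft_ofShape_bin k a₁ a₂ e i s t v x y Z

theorem graft_mem {a₁ a₂ : ℤ} {m n N : ℕ} {d e D : ℤ} {i : ℕ} (hi : 1 ≤ i ∧ i ≤ m)
    (hN : N + 1 = m + n) (hD : d + e = D) {X Y : Tree k E₁ E₂}
    (hX : X ∈ piece k a₁ a₂ m d) (hY : Y ∈ piece k a₁ a₂ n e) :
    graft k a₁ a₂ e i X Y ∈ piece k a₁ a₂ N D := by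
  refine piece_induction (p := fun X => graft k a₁ a₂ e i X Y ∈ piece k a₁ a₂ N D) ?_ ?_ ?_ hX
  · simp
  · intro X X' h h'; rw [map_add, LinearMap.add_apply]; exact add_mem h h'
  rintro s x rfl rfl
  refine shape_induction (p := fun s X => ∀ i N D, 1 ≤ i ∧ i ≤ s.arity → N + 1 = s.arity + n →
    s.degree a₁ a₂ + e = D → graft k a₁ a₂ e i X Y ∈ piece k a₁ a₂ N D) ?_ ?_ ?_ ?_ ?_
    s x i N D hi hN hD
  · intros; simp
  · intro s X X' h h' i N D hi hN hD
    rw [map_add, LinearMap.add_apply]; exact add_mem (h i N D hi hN hD) (h' i N D hi hN hD)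
  · intro c i N D hi hN hD
    simp only [Shape.arity, Shape.degree] at hi hN hD
    obtain rfl : N = n := by omega
    obtain rfl : e = D := by omega
    rw [map_smul, LinearMap.smul_apply, graft_leafT, if_pos (by omega)]
    exact Submodule.smul_mem _ _ hY
  · intro t v x ih i N D hi hN hD
    simp only [Shape.arity, Shape.degree] at hi hN hD
    rw [graft_ofShape_un]
    obtain rfl : a₁ + (t.degree a₁ a₂ + e) = D := by omega
    exact unT_mem v (ih i N _ hi hN rfl)
  · intro l r v x y ihl ihr i N D hi hN hD
    simp only [Shape.arity, Shape.degree] at hi hN hD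
    rw [graft_ofShape_bin]
    split_ifs with h
    · refine Submodule.smul_mem _ _ ?_
      obtain rfl : N = l.arity + n - 1 + r.arity := by omega
      obtain rfl : a₂ + (l.degree a₁ a₂ + e + r.degree a₁ a₂) = D := by omega
      exact binT_mem v (ihl i (l.arity + n - 1) _ ⟨hi.1, h⟩ (by omega) rfl)
        (ofShape_mem k a₁ a₂ r y)
    · obtain rfl : N = l.arity + (r.arity + n - 1) := by omega
      obtain rfl : a₂ + (l.degree a₁ a₂ + (r.degree a₁ a₂ + e)) = D := by omega
      exact binT_mem v (ofShape_mem k a₁ a₂ l x)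
        (ihr (i - l.arity) (r.arity + n - 1) _ ⟨by omega, by omega⟩ (by omega) rfl)

theorem graft_leafT_right {a₁ a₂ : ℤ} {m : ℕ} {d : ℤ} {i : ℕ} (hi : 1 ≤ i ∧ i ≤ m)
    {X : Tree k E₁ E₂} (hX : X ∈ piece k a₁ a₂ m d) :
    graft k a₁ a₂ 0 i X (leafT k) = X := by
  refine piece_induction (p := fun X => graft k a₁ a₂ 0 i X (leafT k) = X) ?_ ?_ ?_ hX
  · simp
  · intro X X' h h'; rw [map_add, LinearMap.add_apply, h, h']
  rintro s x rfl rfl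
  refine shape_induction (p := fun s X => ∀ i, 1 ≤ i ∧ i ≤ s.arity →
    graft k a₁ a₂ 0 i X (leafT k) = X) ?_ ?_ ?_ ?_ ?_ s x i hi
  · intros; simp
  · intro s X X' h h' i hi; rw [map_add, LinearMap.add_apply, h i hi, h' i hi]
  · intro c i hi
    simp only [Shape.arity] at hi
    rw [map_smul, LinearMap.smul_apply, graft_leafT, if_pos (by omega)]
  · intro t v x ih i hi
    rw [graft_ofShape_un, ih i hi]
  · intro l r v x y ihl ihr i hi
    simp only [Shape.arity] at hi
    rw [graft_ofShape_bin, mul_zero, sgn_zero, one_smul]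
    split_ifs with h
    · rw [ihl i ⟨hi.1, h⟩]
    · rw [ihr _ ⟨by omega, by omega⟩]

theorem graft_seq {a₁ a₂ : ℤ} {m n : ℕ} {d e f : ℤ} {i j : ℕ} (hi : 1 ≤ i ∧ i ≤ m)
    (hj : 1 ≤ j ∧ j ≤ n) {X Y : Tree k E₁ E₂}
    (hX : X ∈ piece k a₁ a₂ m d) (hY : Y ∈ piece k a₁ a₂ n e) (Z : Tree k E₁ E₂) :
    graft k a₁ a₂ f (i - 1 + j) (graft k a₁ a₂ e i X Y) Z =
      graft k a₁ a₂ (e + f) i X (graft k a₁ a₂ f j Y Z) := by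
  refine piece_induction (p := fun X =>
    graft k a₁ a₂ f (i - 1 + j) (graft k a₁ a₂ e i X Y) Z =
      graft k a₁ a₂ (e + f) i X (graft k a₁ a₂ f j Y Z)) ?_ ?_ ?_ hX
  · simp
  · intro X X' h h'; simp only [map_add, LinearMap.add_apply, h, h']
  rintro s x rfl rfl
  refine shape_induction (p := fun s X => ∀ i, 1 ≤ i ∧ i ≤ s.arity →
    graft k a₁ a₂ f (i - 1 + j) (graft k a₁ a₂ e i X Y) Z =
      graft k a₁ a₂ (e + f) i X (graft k a₁ a₂ f j Y Z)) ?_ ?_ ?_ ?_ ?_ s x i hi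
  · intros; simp
  · intro s X X' h h' i hi; simp only [map_add, LinearMap.add_apply, h i hi, h' i hi]
  · intro c i hi
    simp only [Shape.arity] at hi
    obtain rfl : i = 1 := by omega
    simp [graft_leafT]
  · intro t v x ih i hi
    simp only [Shape.arity] at hi
    rw [graft_ofShape_un, graft_ofShape_un, ← ih i hi]
    exact graft_unT _ v (graft_mem (N := t.arity + n - 1) hi (by omega) rfl
      (ofShape_mem k a₁ a₂ t x) hY) Z
  · intro l r v x y ihl ihr i hi
    simp only [Shape.arity] at hi
    rw [graft_ofShape_bin, graft_ofShape_bin]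
    split_ifs with h
    · rw [map_smul, LinearMap.smul_apply, graft_binT _ v
        (graft_mem (N := l.arity + n - 1) ⟨hi.1, h⟩ (by omega) rfl (ofShape_mem k a₁ a₂ l x) hY)
        (ofShape_mem k a₁ a₂ r y), if_pos (by omega), ihl i ⟨hi.1, h⟩, smul_smul, mul_add, sgn_add]
    · rw [graft_binT _ v (ofShape_mem k a₁ a₂ l x)
        (graft_mem (N := r.arity + n - 1) (i := i - l.arity) ⟨by omega, by omega⟩ (by omega) rfl
          (ofShape_mem k a₁ a₂ r y) hY), if_neg (by omega),
        ← ihr (i - l.arity) ⟨by omega, by omega⟩,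
        show i - 1 + j - l.arity = i - l.arity - 1 + j by omega]

theorem graft_par {a₁ a₂ : ℤ} {m n p : ℕ} {d e f : ℤ} {i j : ℕ} (hi : 1 ≤ i) (hij : i < j)
    (hj : j ≤ m) {X Y Z : Tree k E₁ E₂} (hX : X ∈ piece k a₁ a₂ m d)
    (hY : Y ∈ piece k a₁ a₂ n e) (hZ : Z ∈ piece k a₁ a₂ p f) :
    graft k a₁ a₂ f (j - 1 + n) (graft k a₁ a₂ e i X Y) Z =
      sgn k (e * f) • graft k a₁ a₂ e i (graft k a₁ a₂ f j X Z) Y := by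
  refine piece_induction (p := fun X =>
    graft k a₁ a₂ f (j - 1 + n) (graft k a₁ a₂ e i X Y) Z =
      sgn k (e * f) • graft k a₁ a₂ e i (graft k a₁ a₂ f j X Z) Y) ?_ ?_ ?_ hX
  · simp
  · intro X X' h h'; simp only [map_add, LinearMap.add_apply, h, h', smul_add]
  rintro s x rfl rfl
  refine shape_induction (p := fun s X => ∀ i j, 1 ≤ i → i < j → j ≤ s.arity →
    graft k a₁ a₂ f (j - 1 + n) (graft k a₁ a₂ e i X Y) Z =
      sgn k (e * f) • graft k a₁ a₂ e i (graft k a₁ a₂ f j X Z) Y) ?_ ?_ ?_ ?_ ?_ s x i j hi hij hj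
  · intros; simp
  · intro s X X' h h' i j hi hij hj
    simp only [map_add, LinearMap.add_apply, h i j hi hij hj, h' i j hi hij hj, smul_add]
  · intro c i j hi hij hj
    simp only [Shape.arity] at hj
    omega
  · intro t v x ih i j hi hij hj
    simp only [Shape.arity] at hj
    rw [graft_ofShape_un, graft_ofShape_un,
      graft_unT _ v (graft_mem (N := t.arity + n - 1) ⟨hi, by omega⟩ (by omega) rfl
        (ofShape_mem k a₁ a₂ t x) hY),
      graft_unT _ v (graft_mem (N := t.arity + p - 1) (i := j) ⟨by omega, by omega⟩ (by omega) rfl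
        (ofShape_mem k a₁ a₂ t x) hZ), ih i j hi hij hj, map_smul]
  · intro l r v x y ihl ihr i j hi hij hj
    simp only [Shape.arity] at hj
    have hx := ofShape_mem k a₁ a₂ l x
    have hy := ofShape_mem k a₁ a₂ r y
    rw [graft_ofShape_bin, graft_ofShape_bin]
    by_cases h1 : j ≤ l.arity
    · rw [if_pos (by omega : i ≤ l.arity), if_pos h1]
      rw [map_smul, LinearMap.smul_apply, graft_binT _ v
        (graft_mem (N := l.arity + n - 1) ⟨hi, by omega⟩ (by omega) rfl hx hY) hy,
        if_pos (by omega), ihl i j hi hij h1]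
      simp only [map_smul, LinearMap.smul_apply]
      rw [graft_binT _ v
        (graft_mem (N := l.arity + p - 1) (i := j) ⟨by omega, h1⟩ (by omega) rfl hx hZ) hy,
        if_pos (by omega)]
      simp only [smul_smul]
      congr 1
      ring
    · rw [if_neg h1]
      by_cases h2 : i ≤ l.arity
      · rw [if_pos h2, map_smul, LinearMap.smul_apply, graft_binT _ v
          (graft_mem (N := l.arity + n - 1) ⟨hi, by omega⟩ (by omega) rfl hx hY) hy,
          if_neg (by omega), graft_binT _ v hx
          (graft_mem (N := r.arity + p - 1) (i := j - l.arity) ⟨by omega, by omega⟩ (by omega) rfl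
            hy hZ), if_pos h2, smul_smul, ← sgn_add,
          show j - 1 + n - (l.arity + n - 1) = j - l.arity by omega,
          show e * f + (r.degree a₁ a₂ + f) * e = r.degree a₁ a₂ * e + (e * f + e * f) by ring,
          sgn_add, sgn_add, sgn_mul_self, mul_one]
      · rw [if_neg h2, graft_binT _ v hx
          (graft_mem (N := r.arity + n - 1) (i := i - l.arity) ⟨by omega, by omega⟩ (by omega) rfl
            hy hY), if_neg (by omega), graft_binT _ v hx
          (graft_mem (N := r.arity + p - 1) (i := j - l.arity) ⟨by omega, by omega⟩ (by omega) rfl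
            hy hZ), if_neg h2,
          show j - 1 + n - l.arity = j - l.arity - 1 + n by omega,
          ihr (i - l.arity) (j - l.arity) (by omega) (by omega) (by omega), map_smul]

end Grafting

/-! ## Graded ns operads and ns cooperads -/

section Operads

variable (k : Type u) [Field k]

/-- The structure maps of an ns operad in graded vector spaces, in terms of partial compositions:
`obj n d` is the component of arity `n` and degree `d`, and `circ i` is `∘ᵢ` (`1 ≤ i ≤ m`), which
maps arities `m, n` to `N = m + n - 1` and degrees `d, e` to `D = d + e`. -/
structure OperadData where
  obj : ℕ → ℤ → Type u
  [acg : ∀ n d, AddCommGroup (obj n d)]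
  [mod : ∀ n d, Module k (obj n d)]
  one : obj 1 0
  circ : ∀ {m n N : ℕ} {d e D : ℤ} (i : ℕ) (_ : 1 ≤ i ∧ i ≤ m) (_ : N + 1 = m + n)
    (_ : d + e = D), obj m d →ₗ[k] obj n e →ₗ[k] obj N D

attribute [instance] OperadData.acg OperadData.mod

/-- A (reduced) ns operad in graded vector spaces, with the Koszul sign rule. -/
structure NsOperad extends OperadData k where
  reduced : ∀ d, Subsingleton (obj 0 d)
  one_circ : ∀ {n : ℕ} {d : ℤ} (hi : 1 ≤ 1 ∧ 1 ≤ 1) (hN : n + 1 = 1 + n) (hD : 0 + d = d)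
    (Y : obj n d), circ 1 hi hN hD one Y = Y
  circ_one : ∀ {m : ℕ} {d : ℤ} (i : ℕ) (hi : 1 ≤ i ∧ i ≤ m) (hN : m + 1 = m + 1)
    (hD : d + 0 = d) (X : obj m d), circ i hi hN hD X one = X
  /-- `(X ∘ᵢ Y) ∘_{i-1+j} Z = X ∘ᵢ (Y ∘ⱼ Z)`. -/
  circ_seq : ∀ {m n p a b N : ℕ} {d e f s t D : ℤ} (i j : ℕ) (hi : 1 ≤ i ∧ i ≤ m)
    (hj : 1 ≤ j ∧ j ≤ n) (hij : 1 ≤ i - 1 + j ∧ i - 1 + j ≤ a)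
    (ha : a + 1 = m + n) (hs : d + e = s) (hN : N + 1 = a + p) (hD : s + f = D)
    (hb : b + 1 = n + p) (ht : e + f = t) (hN' : N + 1 = m + b) (hD' : d + t = D)
    (X : obj m d) (Y : obj n e) (Z : obj p f),
    circ (i - 1 + j) hij hN hD (circ i hi ha hs X Y) Z = circ i hi hN' hD' X (circ j hj hb ht Y Z)
  /-- `(X ∘ᵢ Y) ∘_{j-1+n} Z = (-1)^{|Y||Z|} (X ∘ⱼ Z) ∘ᵢ Y` for `i < j`. -/
  circ_par : ∀ {m n p a b N : ℕ} {d e f s t D : ℤ} (i j : ℕ) (hi : 1 ≤ i ∧ i ≤ m)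
    (hj : 1 ≤ j ∧ j ≤ m) (_ : i < j) (hja : 1 ≤ j - 1 + n ∧ j - 1 + n ≤ a)
    (hib : 1 ≤ i ∧ i ≤ b)
    (ha : a + 1 = m + n) (hs : d + e = s) (hN : N + 1 = a + p) (hD : s + f = D)
    (hb : b + 1 = m + p) (ht : d + f = t) (hN' : N + 1 = b + n) (hD' : t + e = D)
    (X : obj m d) (Y : obj n e) (Z : obj p f),
    circ (j - 1 + n) hja hN hD (circ i hi ha hs X Y) Z =
      sgn k (e * f) • circ i hib hN' hD' (circ j hj hb ht X Z) Y

variable {k}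

/-- An isomorphism of graded ns operads: linear isomorphisms in every arity and degree that
preserve the identity and all partial compositions. -/
structure OperadIso (O P : OperadData k) where
  map : ∀ n d, O.obj n d ≃ₗ[k] P.obj n d
  map_one : map 1 0 O.one = P.one
  map_circ : ∀ {m n N : ℕ} {d e D : ℤ} (i : ℕ) (hi : 1 ≤ i ∧ i ≤ m) (hN : N + 1 = m + n)
    (hD : d + e = D) (X : O.obj m d) (Y : O.obj n e),
    map N D (O.circ i hi hN hD X Y) = P.circ i hi hN hD (map m d X) (map n e Y)

/-- A (graded) operadic ideal: a family of subspaces that contains `X ∘ᵢ Y` whenever it contains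
`X` or `Y`. -/
structure OperadData.IsIdeal (O : OperadData k) (I : ∀ n d, Submodule k (O.obj n d)) : Prop where
  left : ∀ {m n N : ℕ} {d e D : ℤ} (i : ℕ) (hi : 1 ≤ i ∧ i ≤ m) (hN : N + 1 = m + n)
    (hD : d + e = D), ∀ X ∈ I m d, ∀ Y, O.circ i hi hN hD X Y ∈ I N D
  right : ∀ {m n N : ℕ} {d e D : ℤ} (i : ℕ) (hi : 1 ≤ i ∧ i ≤ m) (hN : N + 1 = m + n)
    (hD : d + e = D), ∀ X, ∀ Y ∈ I n e, O.circ i hi hN hD X Y ∈ I N D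

/-- The ideal `⟨S⟩` generated by `S`: the smallest operadic ideal that contains `S`. -/
def OperadData.ideal (O : OperadData k) (S : ∀ n d, Submodule k (O.obj n d)) (n : ℕ) (d : ℤ) :
    Submodule k (O.obj n d) :=
  ⨅ I : {I : ∀ n d, Submodule k (O.obj n d) // O.IsIdeal I ∧ ∀ n d, S n d ≤ I n d}, I.1 n d

theorem OperadData.isIdeal_ideal (O : OperadData k) (S : ∀ n d, Submodule k (O.obj n d)) :
    O.IsIdeal (O.ideal S) where
  left i hi hN hD X hX Y := by
    simp only [OperadData.ideal, Submodule.mem_iInf] at hX ⊢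
    exact fun I => I.2.1.left i hi hN hD X (hX I) Y
  right i hi hN hD X Y hY := by
    simp only [OperadData.ideal, Submodule.mem_iInf] at hY ⊢
    exact fun I => I.2.1.right i hi hN hD X Y (hY I)

/-- The quotient of an ns operad by an operadic ideal. -/
def NsOperad.quotient (O : NsOperad k) (I : ∀ n d, Submodule k (O.obj n d))
    (hI : O.IsIdeal I) : NsOperad k where
  obj n d := O.obj n d ⧸ I n d
  one := (I 1 0).mkQ O.one
  circ {m n N d e D} i hi hN hD :=
    (I m d).liftQ
      (Submodule.mapQLinear (I n e) (I N D) ∘ₗ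
        (O.circ i hi hN hD).codRestrict (Submodule.compatibleMaps (I n e) (I N D))
          (fun X Y hY => hI.right i hi hN hD X Y hY))
      (fun X hX => by
        rw [LinearMap.mem_ker]
        refine LinearMap.ext fun y => ?_
        obtain ⟨Y, rfl⟩ := (I n e).mkQ_surjective y
        exact (Submodule.Quotient.mk_eq_zero _).2 (hI.left i hi hN hD X hX Y))
  reduced d := by
    have := O.reduced d
    exact (Submodule.mkQ_surjective (I 0 d)).subsingleton
  one_circ {n d} hi hN hD y := by
    obtain ⟨Y, rfl⟩ := (I n d).mkQ_surjective y
    exact congrArg (I n d).mkQ (O.one_circ hi hN hD Y)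
  circ_one {m d} i hi hN hD x := by
    obtain ⟨X, rfl⟩ := (I m d).mkQ_surjective x
    exact congrArg (I m d).mkQ (O.circ_one i hi hN hD X)
  circ_seq {m n p a b N d e f s t D} i j hi hj hij ha hs hN hD hb ht hN' hD' x y z := by
    obtain ⟨X, rfl⟩ := (I m d).mkQ_surjective x
    obtain ⟨Y, rfl⟩ := (I n e).mkQ_surjective y
    obtain ⟨Z, rfl⟩ := (I p f).mkQ_surjective z
    exact congrArg (I N D).mkQ (O.circ_seq i j hi hj hij ha hs hN hD hb ht hN' hD' X Y Z)
  circ_par {m n p a b N d e f s t D} i j hi hj h hja hib ha hs hN hD hb ht hN' hD' x y z := by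
    obtain ⟨X, rfl⟩ := (I m d).mkQ_surjective x
    obtain ⟨Y, rfl⟩ := (I n e).mkQ_surjective y
    obtain ⟨Z, rfl⟩ := (I p f).mkQ_surjective z
    exact congrArg (I N D).mkQ (O.circ_par i j hi hj h hja hib ha hs hN hD hb ht hN' hD' X Y Z)

variable (k)

/-- The structure maps of an ns cooperad in graded vector spaces: the counit (on the component of
arity `1` and degree `0`) and the components
`C(N)_D → C(m)_d ⊗ C(n)_e`, `N = m + n - 1`, `D = d + e`, `1 ≤ i ≤ m`,
of the decomposition map that are dual to the partial compositions `∘ᵢ`. -/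
structure CooperadData where
  obj : ℕ → ℤ → Type u
  [acg : ∀ n d, AddCommGroup (obj n d)]
  [mod : ∀ n d, Module k (obj n d)]
  counit : ∀ {d : ℤ} (_ : d = 0), obj 1 d →ₗ[k] k
  decomp : ∀ {m n N : ℕ} {d e D : ℤ} (i : ℕ) (_ : 1 ≤ i ∧ i ≤ m) (_ : N + 1 = m + n)
    (_ : d + e = D), obj N D →ₗ[k] obj m d ⊗[k] obj n e

attribute [instance] CooperadData.acg CooperadData.mod

variable {k}

/-- A sub-cooperad: a family of subspaces `K` with `Δᵢ(K) ⊆ K ⊗ K` for all components `Δᵢ` of the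
decomposition map. -/
def CooperadData.IsSubcooperad (C : CooperadData k) (K : ∀ n d, Submodule k (C.obj n d)) : Prop :=
  ∀ {m n N : ℕ} {d e D : ℤ} (i : ℕ) (hi : 1 ≤ i ∧ i ≤ m) (hN : N + 1 = m + n) (hD : d + e = D),
    ∀ x ∈ K N D, C.decomp i hi hN hD x ∈
      LinearMap.range (TensorProduct.mapIncl (K m d) (K n e))

theorem mapIncl_injective {M N : Type u} [AddCommGroup M] [Module k M] [AddCommGroup N]
    [Module k N] (p : Submodule k M) (q : Submodule k N) :
    Function.Injective (TensorProduct.mapIncl p q) :=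
  TensorProduct.map_injective_of_flat_flat _ _ p.injective_subtype q.injective_subtype

/-- A sub-cooperad as a cooperad. -/
def CooperadData.sub (C : CooperadData k) (K : ∀ n d, Submodule k (C.obj n d))
    (hK : C.IsSubcooperad K) : CooperadData k where
  obj n d := K n d
  counit h := C.counit h ∘ₗ (K 1 _).subtype
  decomp {m n N d e D} i hi hN hD :=
    (LinearEquiv.ofInjective (TensorProduct.mapIncl (K m d) (K n e))
      (mapIncl_injective _ _)).symm.toLinearMap ∘ₗ
    (C.decomp i hi hN hD ∘ₗ (K N D).subtype).codRestrict
      (LinearMap.range (TensorProduct.mapIncl (K m d) (K n e)))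
      (fun x => hK i hi hN hD x x.2)

/-- The largest sub-cooperad whose component of arity `n` and degree `d` is contained in `S n d`
(the sum of all such sub-cooperads). -/
def CooperadData.largest (C : CooperadData k) (S : ∀ n d, Submodule k (C.obj n d))
    (n : ℕ) (d : ℤ) : Submodule k (C.obj n d) :=
  ⨆ K : {K : ∀ n d, Submodule k (C.obj n d) // C.IsSubcooperad K ∧ ∀ n d, K n d ≤ S n d}, K.1 n d

theorem CooperadData.isSubcooperad_largest (C : CooperadData k)
    (S : ∀ n d, Submodule k (C.obj n d)) : C.IsSubcooperad (C.largest S) := by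
  intro m n N d e D i hi hN hD x hx
  refine Submodule.iSup_induction _ (motive := fun x => C.decomp i hi hN hD x ∈
    LinearMap.range (TensorProduct.mapIncl (C.largest S m d) (C.largest S n e))) hx ?_ ?_ ?_
  · intro K x hx
    obtain ⟨w, hw⟩ := K.2.1 i hi hN hD x hx
    rw [← hw]
    have h1 : K.1 m d ≤ C.largest S m d := le_iSup (fun K : {K : ∀ n d, Submodule k (C.obj n d) //
      C.IsSubcooperad K ∧ ∀ n d, K n d ≤ S n d} => K.1 m d) K
    have h2 : K.1 n e ≤ C.largest S n e := le_iSup (fun K : {K : ∀ n d, Submodule k (C.obj n d) //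
      C.IsSubcooperad K ∧ ∀ n d, K n d ≤ S n d} => K.1 n e) K
    refine ⟨TensorProduct.map (Submodule.inclusion h1) (Submodule.inclusion h2) w, ?_⟩
    rw [TensorProduct.mapIncl, ← LinearMap.comp_apply, ← TensorProduct.map_comp]
    rfl
  · rw [map_zero]; exact zero_mem _
  · intro x y hx hy; rw [map_add]; exact add_mem hx hy

/-- The Hadamard product `𝒮ᶜ ⊗_H C` with the suspension cooperad
`𝒮ᶜ(n) = Hom((sk)^{⊗ n}, sk)`, where `sk` is one-dimensional of degree `1`.

The space `𝒮ᶜ(n)` is one-dimensional of degree `1 - n`, spanned by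
`σₙ : s1 ⊗ ⋯ ⊗ s1 ↦ s1`. In the endomorphism operad of `sk` one has
`σ_m ∘ᵢ σ_n = (-1)^{(i-1)(1-n)} σ_{m+n-1}` (the sign moves `σ_n` past `i-1` copies of `s1`), so that
dually `Δᵢ(σ_{m+n-1}) = (-1)^{(i-1)(1-n)} σ_m ⊗ σ_n`. The product has `𝒮ᶜ(n) ⊗ C(n)` as its
component of arity `n`: in degree `d` this is `σₙ ⊗ C(n)_{d+n-1}`. Its decomposition map is
`Δᵢ(σ_N ⊗ c) = (-1)^{(i-1)(1-n)} ∑ (-1)^{|σ_n||c'|} (σ_m ⊗ c') ⊗ (σ_n ⊗ c'')`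
for `Δᵢ(c) = ∑ c' ⊗ c''`. -/
def CooperadData.suspend (C : CooperadData k) : CooperadData k where
  obj n d := C.obj n (d + (n : ℤ) - 1)
  counit h := C.counit (by rw [h]; norm_num)
  decomp {m n N d e D} i hi hN hD :=
    (sgn k (((i : ℤ) - 1) * (1 - (n : ℤ))) * sgn k ((1 - (n : ℤ)) * (d + (m : ℤ) - 1))) •
      C.decomp (d := d + (m : ℤ) - 1) (e := e + (n : ℤ) - 1) i hi hN (by omega)

/-- The (graded) linear dual `C*` of a cooperad: `C*(n)_d = (C(n)_{-d})*`, with unit the counit of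
`C` and `f ∘ᵢ g = (f ⊗ g) ∘ Δᵢ`, where `(f ⊗ g)(x ⊗ y) = (-1)^{|g||x|} f(x) g(y)`. -/
def CooperadData.linearDual (C : CooperadData k) : OperadData k where
  obj n d := Module.Dual k (C.obj n (-d))
  one := C.counit (by norm_num)
  circ {m n N d e D} i hi hN hD :=
    (TensorProduct.mk k (Module.Dual k (C.obj m (-d))) (Module.Dual k (C.obj n (-e)))).compr₂
      (sgn k (e * -d) •
        ((C.decomp (d := -d) (e := -e) (D := -D) i hi hN (by omega)).dualMap ∘ₗ
          TensorProduct.dualDistrib k (C.obj m (-d)) (C.obj n (-e))))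

end Operads

/-! ## Free operads, cofree cooperads -/

section Free

variable (k : Type u) [Field k]
variable (E₁ E₂ : Type u) [AddCommGroup E₁] [Module k E₁] [AddCommGroup E₂] [Module k E₂]

theorem Shape.arity_pos (s : Shape) : 0 < s.arity := by
  induction s with
  | leaf => exact Nat.one_pos
  | un t ih => exact ih
  | bin l r ihl _ => exact Nat.add_pos_left ihl _

/-- The free ns operad `𝒯(E)` on `E = (0, E₁, E₂, 0, …)`, where `E₁` is placed in degree `a₁` and
`E₂` in degree `a₂`: decorated planar trees with composition by grafting. -/
def free (a₁ a₂ : ℤ) : NsOperad k where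
  obj n d := piece k (E₁ := E₁) (E₂ := E₂) a₁ a₂ n d
  one := ⟨leafT k, leafT_mem k a₁ a₂⟩
  circ {m n N d e D} i hi hN hD :=
    LinearMap.mk₂ k (fun X Y => ⟨graft k a₁ a₂ e i X.1 Y.1, graft_mem hi hN hD X.2 Y.2⟩)
      (fun X X' Y => Subtype.ext (by simp))
      (fun c X Y => Subtype.ext (by simp))
      (fun X Y Y' => Subtype.ext (by simp))
      (fun c X Y => Subtype.ext (by simp))
  reduced d := ⟨fun X Y => by
    have h : ∀ Z : piece k (E₁ := E₁) (E₂ := E₂) a₁ a₂ 0 d, Z = 0 := fun Z => by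
      refine Subtype.ext (DFinsupp.ext fun s => Z.2 s ?_)
      have := s.arity_pos
      omega
    rw [h X, h Y]⟩
  one_circ _ _ _ Y := Subtype.ext (by simp [graft_leafT])
  circ_one i hi _ _ X := Subtype.ext (graft_leafT_right hi X.2)
  circ_seq i j hi hj _ _ _ _ _ _ ht _ _ X Y Z := by
    subst ht
    exact Subtype.ext (graft_seq hi hj X.2 Y.2 Z.1)
  circ_par i j hi hj h _ _ _ _ _ _ _ _ _ _ X Y Z :=
    Subtype.ext (graft_par hi.1 h hj.2 X.2 Y.2 Z.2)

/-- The (conilpotent) cofree ns cooperad `𝒯ᶜ(E)` on `E = (0, E₁, E₂, 0, …)`, where `E₁` is placed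
in degree `a₁` and `E₂` in degree `a₂`: decorated planar trees with decomposition by cutting. -/
def cofree (a₁ a₂ : ℤ) : CooperadData k where
  obj n d := piece k (E₁ := E₁) (E₂ := E₂) a₁ a₂ n d
  counit {d} _ := (decLeaf k E₁ E₂).toLinearMap ∘ₗ
    DirectSum.component k Shape (fun s => Dec k E₁ E₂ s) .leaf ∘ₗ (piece k a₁ a₂ 1 d).subtype
  decomp {m n N d e D} i _ _ _ :=
    TensorProduct.map (proj k a₁ a₂ m d) (proj k a₁ a₂ n e) ∘ₗ
      cut k a₁ a₂ e i ∘ₗ (piece k a₁ a₂ N D).subtype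

end Free

/-! ## Unary binary quadratic operads and their Koszul duals -/

section Quadratic

variable (k : Type u) [Field k]
variable (E₁ E₂ : Type u) [AddCommGroup E₁] [Module k E₁] [AddCommGroup E₂] [Module k E₂]

/-- `𝒯(E)^{(2)}` in arity one, the span of the `α ∘₁ β` with `α, β ∈ E₁`. -/
abbrev Quad₁ : Type u := E₁ ⊗[k] E₁

/-- `𝒯(E)^{(2)}` in arity two; the three summands are the spans of the `α ∘₁ μ`, of the `μ ∘₁ α`
and of the `μ ∘₂ α`, with `α ∈ E₁` and `μ ∈ E₂`. -/
abbrev Quad₂ : Type u := (E₁ ⊗[k] E₂) × (E₂ ⊗[k] E₁) × (E₂ ⊗[k] E₁)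

/-- `𝒯(E)^{(2)}` in arity three; the two summands are the spans of the `μ ∘₁ ν` and of the
`μ ∘₂ ν`, with `μ, ν ∈ E₂`. -/
abbrev Quad₃ : Type u := (E₂ ⊗[k] E₂) × (E₂ ⊗[k] E₂)

variable {E₁ E₂}

/-- The corolla decorated by an element of `E₁`. -/
def corolla₁ : E₁ →ₗ[k] Tree k E₁ E₂ := (unT k).flip (leafT k)

/-- The corolla decorated by an element of `E₂`. -/
def corolla₂ : E₂ →ₗ[k] Tree k E₁ E₂ := ((binT k).flip (leafT k)).flip (leafT k)

/-- `α ⊗ β ↦ α ∘₁ β`. -/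
def quadTree₁ : Quad₁ k E₁ →ₗ[k] Tree k E₁ E₂ :=
  unU k ∘ₗ TensorProduct.map LinearMap.id (corolla₁ k)

/-- `(α ⊗ μ, μ' ⊗ α', μ'' ⊗ α'') ↦ α ∘₁ μ + μ' ∘₁ α' + μ'' ∘₂ α''`. -/
def quadTree₂ : Quad₂ k E₁ E₂ →ₗ[k] Tree k E₁ E₂ :=
  LinearMap.coprod (unU k ∘ₗ TensorProduct.map LinearMap.id (corolla₂ k)) <|
  LinearMap.coprod
    (binU k ∘ₗ TensorProduct.map LinearMap.id
      ((TensorProduct.mk k (Tree k E₁ E₂) (Tree k E₁ E₂)).flip (leafT k) ∘ₗ corolla₁ k))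
    (binU k ∘ₗ TensorProduct.map LinearMap.id
      (TensorProduct.mk k (Tree k E₁ E₂) (Tree k E₁ E₂) (leafT k) ∘ₗ corolla₁ k))

/-- `(μ ⊗ ν, μ' ⊗ ν') ↦ μ ∘₁ ν + μ' ∘₂ ν'`. -/
def quadTree₃ : Quad₃ k E₂ →ₗ[k] Tree k E₁ E₂ :=
  LinearMap.coprod
    (binU k ∘ₗ TensorProduct.map LinearMap.id
      ((TensorProduct.mk k (Tree k E₁ E₂) (Tree k E₁ E₂)).flip (leafT k) ∘ₗ corolla₂ k))
    (binU k ∘ₗ TensorProduct.map LinearMap.id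
      (TensorProduct.mk k (Tree k E₁ E₂) (Tree k E₁ E₂) (leafT k) ∘ₗ corolla₂ k))

variable (E₁ E₂)

/-- The datum `(E, R)` of a unary binary quadratic ns operad `𝒯(E)/⟨R⟩`: the generators are
`E = (0, E₁, E₂, 0, …)` and the relations are an arity graded subspace `R = R₁ ⊔ R₂ ⊔ R₃` of
`𝒯(E)^{(2)}`. -/
structure QuadraticData where
  R₁ : Submodule k (Quad₁ k E₁)
  R₂ : Submodule k (Quad₂ k E₁ E₂)
  R₃ : Submodule k (Quad₃ k E₂)

variable {k E₁ E₂}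

/-- The relations of arity `n` as decorated trees. -/
def QuadraticData.relations (P : QuadraticData k E₁ E₂) (n : ℕ) : Submodule k (Tree k E₁ E₂) :=
  match n with
  | 1 => P.R₁.map (quadTree₁ k)
  | 2 => P.R₂.map (quadTree₂ k)
  | 3 => P.R₃.map (quadTree₃ k)
  | _ => ⊥

/-- The ns operad `𝒯(E)/⟨R⟩`, where `E₁` is placed in degree `a₁` and `E₂` in degree `a₂`.
For `a₁ = a₂ = 0` this is the (ungraded) operad that `(E, R)` presents. -/
def QuadraticData.operad (P : QuadraticData k E₁ E₂) (a₁ a₂ : ℤ) : NsOperad k :=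
  (free k E₁ E₂ a₁ a₂).quotient
    ((free k E₁ E₂ a₁ a₂).ideal fun n d =>
      (P.relations n).comap (piece k (E₁ := E₁) (E₂ := E₂) a₁ a₂ n d).subtype)
    ((free k E₁ E₂ a₁ a₂).isIdeal_ideal _)

/-- The subspace `s²R` of the part of weight two of `𝒯ᶜ(sE)`, and everything in other weights.
Both `sE₁` and `sE₂` have degree `1`, so that the degree in `𝒯ᶜ(sE)` is the weight (the number of
vertices); `s²` puts `s` on both vertices of a tree. -/
def QuadraticData.corelations (P : QuadraticData k E₁ E₂) (n : ℕ) (d : ℤ) :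
    Submodule k ((cofree k E₁ E₂ 1 1).obj n d) :=
  if d = 2 then (P.relations n).comap (piece k (E₁ := E₁) (E₂ := E₂) 1 1 n d).subtype else ⊤

/-- The Koszul dual cooperad `P^¡ = C(sE, s²R)`: the largest sub-cooperad `C` of the cofree
cooperad `𝒯ᶜ(sE)` such that the composite `C → 𝒯ᶜ(sE) → 𝒯ᶜ(sE)^{(2)}/s²R` is zero. -/
def QuadraticData.koszulDualCooperad (P : QuadraticData k E₁ E₂) : CooperadData k :=
  (cofree k E₁ E₂ 1 1).sub ((cofree k E₁ E₂ 1 1).largest P.corelations)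
    ((cofree k E₁ E₂ 1 1).isSubcooperad_largest _)

/-- The Koszul dual operad `P^! = (𝒮ᶜ ⊗_H P^¡)*`. -/
def QuadraticData.koszulDual (P : QuadraticData k E₁ E₂) : OperadData k :=
  P.koszulDualCooperad.suspend.linearDual

/-- `R^⊥ = (R₁^⊥, R₂^⊥, R₃^⊥)`, a datum with generators `E* = (0, E₁*, E₂*, 0, …)`. The orthogonal
subspaces are taken with respect to the bilinear forms `𝒯(E*)^{(2)} ⊗ 𝒯(E)^{(2)} → k` with
`⟨α* ∘₁ β*, α ∘₁ β⟩ = α*(α) β*(β)`,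
`⟨α* ∘₁ μ*, α ∘₁ μ⟩ = - α*(α) μ*(μ)`,
`⟨μ* ∘₁ α*, μ ∘₁ α⟩ = μ*(μ) α*(α)`, `⟨μ* ∘₂ α*, μ ∘₂ α⟩ = μ*(μ) α*(α)`,
`⟨μ* ∘₁ ν*, μ ∘₁ ν⟩ = μ*(μ) ν*(ν)`, `⟨μ* ∘₂ ν*, μ ∘₂ ν⟩ = - μ*(μ) ν*(ν)`,
and zero otherwise; `TensorProduct.dualDistrib` is the map with
`f ⊗ g ↦ (x ⊗ y ↦ f x * g y)`. -/
def QuadraticData.perp (P : QuadraticData k E₁ E₂) :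
    QuadraticData k (Module.Dual k E₁) (Module.Dual k E₂) where
  R₁ :=
    { carrier := {X | ∀ r ∈ P.R₁, TensorProduct.dualDistrib k E₁ E₁ X r = 0}
      zero_mem' := fun r _ => by simp
      add_mem' := fun {X Y} hX hY r hr => by
        rw [map_add, LinearMap.add_apply, hX r hr, hY r hr, add_zero]
      smul_mem' := fun c X hX r hr => by
        rw [map_smul, LinearMap.smul_apply, hX r hr, smul_zero] }
  R₂ :=
    { carrier := {X | ∀ r ∈ P.R₂,
        - TensorProduct.dualDistrib k E₁ E₂ X.1 r.1
        + TensorProduct.dualDistrib k E₂ E₁ X.2.1 r.2.1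
        + TensorProduct.dualDistrib k E₂ E₁ X.2.2 r.2.2 = 0}
      zero_mem' := fun r _ => by simp
      add_mem' := fun {X Y} hX hY r hr => by
        simp only [Prod.fst_add, Prod.snd_add, map_add, LinearMap.add_apply]
        linear_combination hX r hr + hY r hr
      smul_mem' := fun c X hX r hr => by
        simp only [Prod.smul_fst, Prod.smul_snd, map_smul, LinearMap.smul_apply, smul_eq_mul]
        linear_combination c * hX r hr }
  R₃ :=
    { carrier := {X | ∀ r ∈ P.R₃,
        TensorProduct.dualDistrib k E₂ E₂ X.1 r.1
        - TensorProduct.dualDistrib k E₂ E₂ X.2 r.2 = 0}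
      zero_mem' := fun r _ => by simp
      add_mem' := fun {X Y} hX hY r hr => by
        simp only [Prod.fst_add, Prod.snd_add, map_add, LinearMap.add_apply]
        linear_combination hX r hr + hY r hr
      smul_mem' := fun c X hX r hr => by
        simp only [Prod.smul_fst, Prod.smul_snd, map_smul, LinearMap.smul_apply, smul_eq_mul]
        linear_combination c * hX r hr }

theorem corolla₁_mem (a₁ a₂ : ℤ) (v : E₁) :
    corolla₁ k v ∈ piece k (E₁ := E₁) (E₂ := E₂) a₁ a₂ 1 a₁ := by
  have h := unT_mem v (leafT_mem k (E₁ := E₁) (E₂ := E₂) a₁ a₂)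
  rwa [add_zero] at h

theorem corolla₂_mem (a₁ a₂ : ℤ) (v : E₂) :
    corolla₂ k v ∈ piece k (E₁ := E₁) (E₂ := E₂) a₁ a₂ 2 a₂ := by
  have h := binT_mem v (leafT_mem k (E₁ := E₁) (E₂ := E₂) a₁ a₂)
    (leafT_mem k (E₁ := E₁) (E₂ := E₂) a₁ a₂)
  rwa [add_zero, add_zero] at h

/-- The class in `𝒯(E)/⟨R⟩` of a generator in `E₁`. -/
def QuadraticData.gen₁ (P : QuadraticData k E₁ E₂) (a₁ a₂ : ℤ) (v : E₁) :
    (P.operad a₁ a₂).obj 1 a₁ :=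
  Submodule.Quotient.mk (⟨corolla₁ k v, corolla₁_mem a₁ a₂ v⟩ : piece k a₁ a₂ 1 a₁)

/-- The class in `𝒯(E)/⟨R⟩` of a generator in `E₂`. -/
def QuadraticData.gen₂ (P : QuadraticData k E₁ E₂) (a₁ a₂ : ℤ) (v : E₂) :
    (P.operad a₁ a₂).obj 2 a₂ :=
  Submodule.Quotient.mk (⟨corolla₂ k v, corolla₂_mem a₁ a₂ v⟩ : piece k a₁ a₂ 2 a₂)

/-- The functional on `(𝒮ᶜ ⊗_H P^¡)(1)₁ = σ₁ ⊗ sE₁` given by `f ∈ E₁*`, an element of `P^!(1)₋₁`: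
it takes the value `f v` on the corolla decorated by `v ∈ E₁`. -/
def QuadraticData.cogen₁ (P : QuadraticData k E₁ E₂) (f : Module.Dual k E₁) :
    P.koszulDual.obj 1 (-1) :=
  (f ∘ₗ (TensorProduct.rid k E₁).toLinearMap ∘ₗ
    TensorProduct.map LinearMap.id (decLeaf k E₁ E₂).toLinearMap ∘ₗ
    (decUn k E₁ E₂ .leaf).toLinearMap ∘ₗ
    DirectSum.component k Shape (fun s => Dec k E₁ E₂ s) (.un .leaf) ∘ₗ
    (piece k 1 1 1 (-(-1) + ((1 : ℕ) : ℤ) - 1)).subtype) ∘ₗ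
    ((cofree k E₁ E₂ 1 1).largest P.corelations 1 (-(-1) + ((1 : ℕ) : ℤ) - 1)).subtype

/-- The functional on `(𝒮ᶜ ⊗_H P^¡)(2)₀ = σ₂ ⊗ sE₂` given by `f ∈ E₂*`, an element of `P^!(2)₀`:
it takes the value `f v` on the corolla decorated by `v ∈ E₂`. -/
def QuadraticData.cogen₂ (P : QuadraticData k E₁ E₂) (f : Module.Dual k E₂) :
    P.koszulDual.obj 2 0 :=
  (f ∘ₗ (TensorProduct.rid k E₂).toLinearMap ∘ₗ
    TensorProduct.map LinearMap.id ((TensorProduct.rid k k).toLinearMap ∘ₗ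
      TensorProduct.map (decLeaf k E₁ E₂).toLinearMap (decLeaf k E₁ E₂).toLinearMap) ∘ₗ
    (decBin k E₁ E₂ .leaf .leaf).toLinearMap ∘ₗ
    DirectSum.component k Shape (fun s => Dec k E₁ E₂ s) (.bin .leaf .leaf) ∘ₗ
    (piece k 1 1 2 (-0 + ((2 : ℕ) : ℤ) - 1)).subtype) ∘ₗ
    ((cofree k E₁ E₂ 1 1).largest P.corelations 2 (-0 + ((2 : ℕ) : ℤ) - 1)).subtype

end Quadratic

end UnaryBinary

end

/-! The free operad `𝒯(E*)`, with `E₁*` in degree -1 and `E₂*` in degree 0, is put in duality with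
the cofree cooperad `𝒯ᶜ(sE)`. A decorated tree of arity n and degree d pairs with trees of the same
shape, whose weight (number of vertices) is w = -d + n - 1; this shift is the combined effect of the
suspension and of the linear dual. On each shape the pairing is the evaluation of decorations times
a sign, defined recursively from the root.

The signs are chosen so that grafting is adjoint to cutting up to exactly the sign `circSgn` which
occurs in the composition of `(𝒮ᶜ ⊗_H C)*`. This is `pairing_graft`, the core of the proof; it is an
induction on the tree that comes down to identities of signs. Since there are finitely many shapes
of a given weight and `E₁`, `E₂` are finite-dimensional, the pairing is perfect in each arity and
degree (`piecePairing_injective`, `piecePairing_surjective`).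

Orthogonality for this pairing therefore exchanges operadic ideals of `𝒯(E*)` and sub-cooperads of
`𝒯ᶜ(sE)`, reversing inclusions (`isIdeal_orthogonal`, `isSubcooperad_coorthogonal`). In weight two
the pairing is, up to one global sign per arity, the bilinear form that defines `R^⊥`
(`pairing_quadTree₁` and its companions in arities two and three). So the orthogonal of the largest
sub-cooperad subject to `s²R` is the smallest ideal containing `R^⊥`: this is `orthogonal_largest`.

Finally `P^!` consists of the functionals on `P^¡`, that is, of all functionals on `𝒯ᶜ(sE)` modulo
those vanishing on `P^¡`. Perfectness identifies the former with `𝒯(E*)` and `orthogonal_largest`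
identifies the latter with `⟨R^⊥⟩`. Adjunction of grafting and cutting makes the identification
multiplicative, and the pairing with a corolla is the evaluation on generators. -/

noncomputable section

namespace UnaryBinary

/-! ### The signed pairing between `𝒯(E*)` and `𝒯ᶜ(sE)` -/

section Pairing

variable (k : Type u) [Field k]
variable {E₁ E₂ : Type u} [AddCommGroup E₁] [Module k E₁] [AddCommGroup E₂] [Module k E₂]

/-- The pairing between the decorations of a shape by `E*` and by `E`, with the sign that makes
grafting dual to cutting up to the signs of the suspension and of the linear dual. -/
def shapePairing : (s : Shape) →
    Dec k (Module.Dual k E₁) (Module.Dual k E₂) s →ₗ[k] Module.Dual k (Dec k E₁ E₂ s)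
  | .leaf => (decLeaf k E₁ E₂).toLinearMap.dualMap ∘ₗ
      (LinearMap.ringLmapEquivSelf k k k).symm.toLinearMap ∘ₗ (decLeaf k _ _).toLinearMap
  | .un t => sgn k (t.degree 1 1) • ((decUn k E₁ E₂ t).toLinearMap.dualMap ∘ₗ
      TensorProduct.dualDistrib k E₁ (Dec k E₁ E₂ t) ∘ₗ
      TensorProduct.map LinearMap.id (shapePairing t) ∘ₗ (decUn k _ _ t).toLinearMap)
  | .bin l r => sgn k ((l.arity : ℤ) - 1 + l.degree (-1) 0 * r.degree 1 1) •
      ((decBin k E₁ E₂ l r).toLinearMap.dualMap ∘ₗ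
      TensorProduct.dualDistrib k E₂ (Dec k E₁ E₂ l ⊗[k] Dec k E₁ E₂ r) ∘ₗ
      TensorProduct.map LinearMap.id
        (TensorProduct.dualDistrib k (Dec k E₁ E₂ l) (Dec k E₁ E₂ r) ∘ₗ
          TensorProduct.map (shapePairing l) (shapePairing r)) ∘ₗ (decBin k _ _ l r).toLinearMap)

/-- The pairing between `𝒯(E*)` and `𝒯(E)`. -/
def pairing : Tree k (Module.Dual k E₁) (Module.Dual k E₂) →ₗ[k] Module.Dual k (Tree k E₁ E₂) :=
  DirectSum.toModule k Shape _ fun s =>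
    (DirectSum.component k Shape (fun s => Dec k E₁ E₂ s) s).dualMap ∘ₗ shapePairing k s

theorem pairing_ofShape (s : Shape) (x : Dec k (Module.Dual k E₁) (Module.Dual k E₂) s)
    (Y : Tree k E₁ E₂) : pairing k (ofShape k s x) Y = shapePairing k s x (Y s) := by
  simp only [pairing, ofShape, DirectSum.toModule_lof]
  rfl

theorem pairing_ofShape_self (s : Shape) (x : Dec k (Module.Dual k E₁) (Module.Dual k E₂) s)
    (y : Dec k E₁ E₂ s) : pairing k (ofShape k s x) (ofShape k s y) = shapePairing k s x y := by
  rw [pairing_ofShape, ofShape, DirectSum.lof_apply]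

theorem pairing_ofShape_of_ne {s t : Shape} (h : s ≠ t)
    (x : Dec k (Module.Dual k E₁) (Module.Dual k E₂) s)
    (y : Dec k E₁ E₂ t) : pairing k (ofShape k s x) (ofShape k t y) = 0 := by
  rw [pairing_ofShape, ofShape, DirectSum.lof_eq_of, DirectSum.of_eq_of_ne _ _ _ h, map_zero]

variable {k}

theorem tree_induction {p : Tree k E₁ E₂ → Prop} (h0 : p 0)
    (hadd : ∀ X Y, p X → p Y → p (X + Y))
    (hs : ∀ (s : Shape) (x : Dec k E₁ E₂ s), p (ofShape k s x)) (X : Tree k E₁ E₂) : p X := by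
  induction X using DirectSum.induction_on with
  | zero => exact h0
  | of s x => exact hs s x
  | add X Y hX hY => exact hadd X Y hX hY

/-- Case distinction on the root vertex without induction hypotheses; it treats the second argument
of the pairing while the induction runs over the first. -/
theorem tree_cases {p : Tree k E₁ E₂ → Prop} (h0 : p 0)
    (hadd : ∀ X Y, p X → p Y → p (X + Y)) (hleaf : ∀ c : k, p (c • leafT k))
    (hun : ∀ v t (x : Dec k E₁ E₂ t), p (unT k v (ofShape k t x)))
    (hbin : ∀ v l r (x : Dec k E₁ E₂ l) (y : Dec k E₁ E₂ r),
      p (binT k v (ofShape k l x) (ofShape k r y))) (X : Tree k E₁ E₂) : p X :=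
  tree_induction h0 hadd (fun s x => shape_induction (p := fun _ => p) (fun _ => h0)
    (fun _ => hadd) hleaf (fun t v x _ => hun v t x) (fun l r v x y _ _ => hbin v l r x y) s x) X

theorem pairing_leafT_leafT : pairing k (leafT k) (leafT k : Tree k E₁ E₂) = 1 := by
  rw [leafT, leafT, pairing_ofShape_self, shapePairing]
  simp

theorem pairing_leafT_unT (v : E₁) (Y : Tree k E₁ E₂) :
    pairing k (leafT k) (unT k v Y) = 0 := by
  refine tree_induction (p := fun Y => pairing k (leafT k) (unT k v Y) = 0) (by simp)
    (fun X Y hX hY => by simp [hX, hY]) (fun s x => ?_) Y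
  rw [unT_ofShape]
  exact pairing_ofShape_of_ne k (by simp) _ _

theorem pairing_leafT_binT (v : E₂) (Y Z : Tree k E₁ E₂) :
    pairing k (leafT k) (binT k v Y Z) = 0 := by
  refine tree_induction (p := fun Y => pairing k (leafT k) (binT k v Y Z) = 0) (by simp)
    (fun X Y hX hY => by simp [hX, hY]) (fun s x => ?_) Y
  refine tree_induction (p := fun Z => pairing k (leafT k) (binT k v (ofShape k s x) Z) = 0)
    (by simp) (fun X Y hX hY => by simp [hX, hY]) (fun t y => ?_) Z
  rw [binT_ofShape]
  exact pairing_ofShape_of_ne k (by simp) _ _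

theorem pairing_unT_leafT (f : Module.Dual k E₁) (X : Tree k (Module.Dual k E₁) (Module.Dual k E₂)) :
    pairing k (unT k f X) (leafT k) = 0 := by
  refine tree_induction (p := fun X => pairing k (unT k f X) (leafT k) = 0) (by simp)
    (fun X Y hX hY => by simp [hX, hY]) (fun s x => ?_) X
  rw [unT_ofShape]
  exact pairing_ofShape_of_ne k (by simp) _ _

theorem pairing_binT_leafT (f : Module.Dual k E₂)
    (X X' : Tree k (Module.Dual k E₁) (Module.Dual k E₂)) :
    pairing k (binT k f X X') (leafT k) = 0 := by
  refine tree_induction (p := fun X => pairing k (binT k f X X') (leafT k) = 0) (by simp)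
    (fun X Y hX hY => by simp [hX, hY]) (fun s x => ?_) X
  refine tree_induction (p := fun X' => pairing k (binT k f (ofShape k s x) X') (leafT k) = 0)
    (by simp) (fun X Y hX hY => by simp [hX, hY]) (fun t y => ?_) X'
  rw [binT_ofShape]
  exact pairing_ofShape_of_ne k (by simp) _ _

theorem pairing_unT_binT (f : Module.Dual k E₁)
    (X : Tree k (Module.Dual k E₁) (Module.Dual k E₂)) (v : E₂) (Y Z : Tree k E₁ E₂) :
    pairing k (unT k f X) (binT k v Y Z) = 0 := by
  refine tree_induction (p := fun X => pairing k (unT k f X) (binT k v Y Z) = 0) (by simp)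
    (fun X Y hX hY => by simp [hX, hY]) (fun s x => ?_) X
  refine tree_induction (p := fun Y => pairing k (unT k f (ofShape k s x)) (binT k v Y Z) = 0)
    (by simp) (fun X Y hX hY => by simp [hX, hY]) (fun l y => ?_) Y
  refine tree_induction
    (p := fun Z => pairing k (unT k f (ofShape k s x)) (binT k v (ofShape k l y) Z) = 0)
    (by simp) (fun X Y hX hY => by simp [hX, hY]) (fun r z => ?_) Z
  rw [unT_ofShape, binT_ofShape]
  exact pairing_ofShape_of_ne k (by simp) _ _

theorem pairing_binT_unT (f : Module.Dual k E₂)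
    (X X' : Tree k (Module.Dual k E₁) (Module.Dual k E₂)) (v : E₁) (Y : Tree k E₁ E₂) :
    pairing k (binT k f X X') (unT k v Y) = 0 := by
  refine tree_induction (p := fun X => pairing k (binT k f X X') (unT k v Y) = 0) (by simp)
    (fun X Y hX hY => by simp [hX, hY]) (fun l x => ?_) X
  refine tree_induction (p := fun X' => pairing k (binT k f (ofShape k l x) X') (unT k v Y) = 0)
    (by simp) (fun X Y hX hY => by simp [hX, hY]) (fun r x' => ?_) X'
  refine tree_induction
    (p := fun Y => pairing k (binT k f (ofShape k l x) (ofShape k r x')) (unT k v Y) = 0)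
    (by simp) (fun X Y hX hY => by simp [hX, hY]) (fun s y => ?_) Y
  rw [unT_ofShape, binT_ofShape]
  exact pairing_ofShape_of_ne k (by simp) _ _

/-- A unary vertex has degree -1 and a binary one raises the arity by one, so each vertex
contributes exactly one to the right-hand side. This is the dictionary between degrees in `𝒯(E*)`
and weights in `𝒯ᶜ(sE)`. -/
theorem Shape.degree_one_one (s : Shape) :
    s.degree 1 1 = -s.degree (-1) 0 + (s.arity : ℤ) - 1 := by
  induction s with
  | leaf => simp [Shape.degree, Shape.arity]
  | un t ih => simp only [Shape.degree, Shape.arity, ih]; ring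
  | bin l r ihl ihr => simp only [Shape.degree, Shape.arity, ihl, ihr]; push_cast; ring

/-- The recursive sign of `shapePairing` depends on the shape only through its weight, hence only
through arity and degree. The recursion thus extends from single shapes to homogeneous elements. -/
theorem pairing_unT_unT {n : ℕ} {d : ℤ} (f : Module.Dual k E₁)
    {X : Tree k (Module.Dual k E₁) (Module.Dual k E₂)} (hX : X ∈ piece k (-1) 0 n d)
    (v : E₁) (Y : Tree k E₁ E₂) :
    pairing k (unT k f X) (unT k v Y) = sgn k (-d + (n : ℤ) - 1) * (f v * pairing k X Y) := by
  refine piece_induction (p := fun X => pairing k (unT k f X) (unT k v Y) =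
    sgn k (-d + (n : ℤ) - 1) * (f v * pairing k X Y)) (by simp)
    (fun X Y hX hY => by simp only [map_add, LinearMap.add_apply, hX, hY]; ring) ?_ hX
  rintro s x rfl rfl
  refine tree_induction (p := fun Y => pairing k (unT k f (ofShape k s x)) (unT k v Y) =
    sgn k (-s.degree (-1) 0 + (s.arity : ℤ) - 1) * (f v * pairing k (ofShape k s x) Y)) (by simp)
    (fun X Y hX hY => by simp only [map_add, hX, hY]; ring) (fun t y => ?_) Y
  rw [unT_ofShape, unT_ofShape, ← Shape.degree_one_one]
  by_cases h : s = t
  · subst h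
    rw [pairing_ofShape_self, pairing_ofShape_self, shapePairing]
    simp
  · rw [pairing_ofShape_of_ne k h, pairing_ofShape_of_ne k (by simpa using h)]
    simp

theorem pairing_binT_binT {m n : ℕ} {d e : ℤ} (f : Module.Dual k E₂)
    {X X' : Tree k (Module.Dual k E₁) (Module.Dual k E₂)} (hX : X ∈ piece k (-1) 0 m d)
    (hX' : X' ∈ piece k (-1) 0 n e) (v : E₂) (Y Y' : Tree k E₁ E₂) :
    pairing k (binT k f X X') (binT k v Y Y') =
      sgn k ((m : ℤ) - 1 + d * (-e + (n : ℤ) - 1)) *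
        (f v * (pairing k X Y * pairing k X' Y')) := by
  refine piece_induction (p := fun X => pairing k (binT k f X X') (binT k v Y Y') =
    sgn k ((m : ℤ) - 1 + d * (-e + (n : ℤ) - 1)) *
        (f v * (pairing k X Y * pairing k X' Y'))) (by simp)
    (fun X Y hX hY => by simp only [map_add, LinearMap.add_apply, hX, hY]; ring) ?_ hX
  rintro l x rfl rfl
  refine piece_induction (p := fun X' => pairing k (binT k f (ofShape k l x) X') (binT k v Y Y') =
    sgn k ((l.arity : ℤ) - 1 + l.degree (-1) 0 * (-e + (n : ℤ) - 1)) *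
        (f v * (pairing k (ofShape k l x) Y * pairing k X' Y'))) (by simp)
    (fun X Y hX hY => by simp only [map_add, LinearMap.add_apply, hX, hY]; ring) ?_ hX'
  rintro r x' rfl rfl
  rw [← Shape.degree_one_one]
  refine tree_induction (p := fun Y =>
    pairing k (binT k f (ofShape k l x) (ofShape k r x')) (binT k v Y Y') =
    sgn k ((l.arity : ℤ) - 1 + l.degree (-1) 0 * r.degree 1 1) *
        (f v * (pairing k (ofShape k l x) Y * pairing k (ofShape k r x') Y'))) (by simp)
    (fun X Y hX hY => by simp only [map_add, LinearMap.add_apply, hX, hY]; ring) ?_ Y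
  intro l' y
  refine tree_induction (p := fun Y' =>
    pairing k (binT k f (ofShape k l x) (ofShape k r x')) (binT k v (ofShape k l' y) Y') =
    sgn k ((l.arity : ℤ) - 1 + l.degree (-1) 0 * r.degree 1 1) *
        (f v * (pairing k (ofShape k l x) (ofShape k l' y) * pairing k (ofShape k r x') Y')))
    (by simp) (fun X Y hX hY => by simp only [map_add, hX, hY]; ring) ?_ Y'
  intro r' y'
  rw [binT_ofShape, binT_ofShape]
  by_cases h : l = l'
  · subst h
    by_cases h' : r = r'
    · subst h'
      rw [pairing_ofShape_self, pairing_ofShape_self, pairing_ofShape_self, shapePairing]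
      simp
    · rw [pairing_ofShape_of_ne k h', pairing_ofShape_of_ne k (by simpa using h')]
      simp
  · rw [pairing_ofShape_of_ne k h, pairing_ofShape_of_ne k (by simp [h])]
    simp

/-- Only equal shapes pair nontrivially, and the shape determines arity and weight. -/
theorem pairing_eq_zero {m n : ℕ} {d e : ℤ} {X : Tree k (Module.Dual k E₁) (Module.Dual k E₂)}
    (hX : X ∈ piece k (-1) 0 m d) {Y : Tree k E₁ E₂} (hY : Y ∈ piece k 1 1 n e)
    (h : ¬(n = m ∧ e = -d + (m : ℤ) - 1)) : pairing k X Y = 0 := by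
  refine piece_induction (p := fun X => pairing k X Y = 0) (by simp)
    (fun X X' h h' => by simp [h, h']) ?_ hX
  rintro s x rfl rfl
  rw [← Shape.degree_one_one] at h
  rw [pairing_ofShape, hY s fun hs => h ⟨hs.1.symm, hs.2.symm⟩, map_zero]

theorem pairing_proj {n : ℕ} {d e : ℤ} {X : Tree k (Module.Dual k E₁) (Module.Dual k E₂)}
    (hX : X ∈ piece k (-1) 0 n d) (he : e = -d + (n : ℤ) - 1) (Y : Tree k E₁ E₂) :
    pairing k X (proj k 1 1 n e Y) = pairing k X Y := by
  refine piece_induction (p := fun X => pairing k X (proj k 1 1 n e Y) = pairing k X Y) (by simp)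
    (fun X X' h h' => by simp [h, h']) ?_ hX
  rintro s x rfl rfl
  rw [← Shape.degree_one_one] at he
  rw [pairing_ofShape, pairing_ofShape]
  congr 1
  exact (DFinsupp.filter_apply _ _ _).trans (if_pos ⟨rfl, he.symm⟩)

end Pairing

/-! ### Grafting is adjoint to cutting -/

section GraftCut

variable {k : Type u} [Field k]
variable {E₁ E₂ : Type u} [AddCommGroup E₁] [Module k E₁] [AddCommGroup E₂] [Module k E₂]

theorem eq_zero_of_mem_piece_zero {a₁ a₂ d : ℤ} {X : Tree k E₁ E₂}
    (hX : X ∈ piece k a₁ a₂ 0 d) : X = 0 :=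
  DFinsupp.ext fun s => hX s fun h => s.arity_pos.ne' h.1

/-- An index beyond the arity always passes to the right subtree and finally reaches a leaf with an
index different from 1. This matches the cuts, where the left branch is not guarded by a bound on
the index. -/
theorem graft_eq_zero {a₁ a₂ e : ℤ} {m : ℕ} {d : ℤ} {i : ℕ} (hi : m < i)
    {X : Tree k E₁ E₂} (hX : X ∈ piece k a₁ a₂ m d) (Z : Tree k E₁ E₂) :
    graft k a₁ a₂ e i X Z = 0 := by
  refine piece_induction (p := fun X => graft k a₁ a₂ e i X Z = 0) (by simp)
    (fun X X' h h' => by simp [h, h']) ?_ hX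
  rintro s x rfl -
  refine shape_induction (p := fun s X => ∀ i, s.arity < i → graft k a₁ a₂ e i X Z = 0)
    (by simp) (fun s X X' h h' i hi => by simp [h i hi, h' i hi]) ?_ ?_ ?_ s x i hi
  · intro c i hi
    simp only [Shape.arity] at hi
    rw [map_smul, LinearMap.smul_apply, graft_leafT, if_neg (by omega), smul_zero]
  · intro t v x ih i hi
    rw [graft_ofShape_un, ih i hi, map_zero]
  · intro l r v x y ihl ihr i hi
    simp only [Shape.arity] at hi
    rw [graft_ofShape_bin, if_neg (by omega), ihr _ (by omega), map_zero]

theorem graft_mem_of_pos {a₁ a₂ : ℤ} {m n N : ℕ} {d e D : ℤ} {i : ℕ} (hi : 1 ≤ i)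
    (hN : N + 1 = m + n) (hD : d + e = D) {X Y : Tree k E₁ E₂}
    (hX : X ∈ piece k a₁ a₂ m d) (hY : Y ∈ piece k a₁ a₂ n e) :
    graft k a₁ a₂ e i X Y ∈ piece k a₁ a₂ N D := by
  by_cases h : i ≤ m
  · exact graft_mem ⟨hi, h⟩ hN hD hX hY
  · rw [graft_eq_zero (by omega) hX]
    exact zero_mem _

theorem cut_leafT (a₁ a₂ e : ℤ) (i : ℕ) :
    cut k a₁ a₂ e i (leafT k : Tree k E₁ E₂) = if i = 1 then leafT k ⊗ₜ leafT k else 0 := by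
  simp only [cut, leafT, ofShape, DirectSum.toModule_lof]
  rw [cutS, rootCut]
  split_ifs <;> simp [leafT]

theorem cut_unT (a₁ a₂ e : ℤ) (i : ℕ) (v : E₁) (X : Tree k E₁ E₂) :
    cut k a₁ a₂ e i (unT k v X) =
      (if i = 1 then leafT k ⊗ₜ unT k v X else 0) + unCut k (v ⊗ₜ cut k a₁ a₂ e i X) := by
  refine tree_induction (p := fun X => cut k a₁ a₂ e i (unT k v X) =
      (if i = 1 then leafT k ⊗ₜ unT k v X else 0) + unCut k (v ⊗ₜ cut k a₁ a₂ e i X)) (by simp)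
    ?_ (fun s x => ?_) X
  · intro X Y hX hY
    simp only [map_add, hX, hY, TensorProduct.tmul_add]
    split_ifs <;> abel
  · rw [unT_ofShape]
    simp only [cut, ofShape, DirectSum.toModule_lof]
    rw [cutS, rootCut]
    split_ifs <;> simp

/-- In contrast to `cut_unT`, the subtrees must have fixed shapes, because the Koszul sign involves
the degree of `r` and the index shift involves the arity of `l`. -/
theorem cut_binT (a₁ a₂ e : ℤ) (i : ℕ) (v : E₂) (l r : Shape) (x : Dec k E₁ E₂ l)
    (y : Dec k E₁ E₂ r) :
    cut k a₁ a₂ e i (binT k v (ofShape k l x) (ofShape k r y)) =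
      (if i = 1 then leafT k ⊗ₜ binT k v (ofShape k l x) (ofShape k r y) else 0) +
      sgn k (r.degree a₁ a₂ * e) •
        binCutL k (v ⊗ₜ (cut k a₁ a₂ e i (ofShape k l x) ⊗ₜ ofShape k r y)) +
      (if l.arity < i then
        binCutR k (v ⊗ₜ (ofShape k l x ⊗ₜ cut k a₁ a₂ e (i - l.arity) (ofShape k r y)))
      else 0) := by
  rw [binT_ofShape]
  simp only [cut, ofShape, DirectSum.toModule_lof]
  rw [cutS, rootCut]
  split_ifs <;> simp

/-- The functional `X' ⊗ X'' ↦ ⟨X, X'⟩ ⟨Y, X''⟩`. -/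
abbrev pairing₂ (X Y : Tree k (Module.Dual k E₁) (Module.Dual k E₂)) :
    Module.Dual k (Tree k E₁ E₂ ⊗[k] Tree k E₁ E₂) :=
  TensorProduct.dualDistrib k _ _ (pairing k X ⊗ₜ pairing k Y)

theorem pairing₂_zero (Y : Tree k (Module.Dual k E₁) (Module.Dual k E₂))
    (W : Tree k E₁ E₂ ⊗[k] Tree k E₁ E₂) : pairing₂ 0 Y W = 0 := by
  rw [pairing₂, map_zero, TensorProduct.zero_tmul, map_zero, LinearMap.zero_apply]

theorem pairing₂_add (X X' Y : Tree k (Module.Dual k E₁) (Module.Dual k E₂))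
    (W : Tree k E₁ E₂ ⊗[k] Tree k E₁ E₂) :
    pairing₂ (X + X') Y W = pairing₂ X Y W + pairing₂ X' Y W := by
  rw [pairing₂, map_add, TensorProduct.add_tmul, map_add, LinearMap.add_apply]

theorem pairing₂_smul (c : k) (X Y : Tree k (Module.Dual k E₁) (Module.Dual k E₂))
    (W : Tree k E₁ E₂ ⊗[k] Tree k E₁ E₂) :
    pairing₂ (c • X) Y W = c * pairing₂ X Y W := by
  rw [pairing₂, map_smul, ← TensorProduct.smul_tmul', map_smul, LinearMap.smul_apply, smul_eq_mul]

/-- Adding a root to a cut tree changes only the factor that contains the root. On pure tensors the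
claim is therefore the recursion of the pairing in that factor; the analogous lemmas for other roots
follow in the same way. -/
theorem pairing₂_unCut_of_un {n : ℕ} {d : ℤ} (f : Module.Dual k E₁)
    {X : Tree k (Module.Dual k E₁) (Module.Dual k E₂)} (hX : X ∈ piece k (-1) 0 n d)
    (Y : Tree k (Module.Dual k E₁) (Module.Dual k E₂)) (v : E₁)
    (W : Tree k E₁ E₂ ⊗[k] Tree k E₁ E₂) :
    pairing₂ (unT k f X) Y (unCut k (v ⊗ₜ W)) =
      sgn k (-d + (n : ℤ) - 1) * (f v * pairing₂ X Y W) := by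
  induction W with
  | zero => simp
  | add W W' h h' => simp only [TensorProduct.tmul_add, map_add, h, h']; ring
  | tmul Z Z' =>
    simp only [unCut, unU, LinearMap.comp_apply, LinearEquiv.coe_coe,
      TensorProduct.assoc_symm_tmul, TensorProduct.map_tmul, TensorProduct.lift.tmul,
      LinearMap.id_apply, TensorProduct.dualDistrib_apply, pairing_unT_unT f hX]
    ring

theorem pairing₂_unCut_of_bin (f : Module.Dual k E₂)
    (X X' Y : Tree k (Module.Dual k E₁) (Module.Dual k E₂)) (v : E₁)
    (W : Tree k E₁ E₂ ⊗[k] Tree k E₁ E₂) :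
    pairing₂ (binT k f X X') Y (unCut k (v ⊗ₜ W)) = 0 := by
  induction W with
  | zero => simp
  | add W W' h h' => simp only [TensorProduct.tmul_add, map_add, h, h', add_zero]
  | tmul Z Z' => simp [unCut, unU, pairing_binT_unT]

theorem pairing₂_unCut_of_leaf (Y : Tree k (Module.Dual k E₁) (Module.Dual k E₂)) (v : E₁)
    (W : Tree k E₁ E₂ ⊗[k] Tree k E₁ E₂) :
    pairing₂ (leafT k) Y (unCut k (v ⊗ₜ W)) = 0 := by
  induction W with
  | zero => simp
  | add W W' h h' => simp only [TensorProduct.tmul_add, map_add, h, h', add_zero]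
  | tmul Z Z' => simp [unCut, unU, pairing_leafT_unT]

theorem binCutL_tmul (v : E₂) (Z Z' A : Tree k E₁ E₂) :
    binCutL k (v ⊗ₜ ((Z ⊗ₜ Z') ⊗ₜ A)) = binT k v Z A ⊗ₜ Z' := by
  simp [binCutL, binU]

theorem binCutR_tmul (v : E₂) (A Z Z' : Tree k E₁ E₂) :
    binCutR k (v ⊗ₜ (A ⊗ₜ (Z ⊗ₜ Z'))) = binT k v A Z ⊗ₜ Z' := by
  simp [binCutR, binU]

theorem pairing₂_binCutL_of_un (f : Module.Dual k E₁)
    (X Y : Tree k (Module.Dual k E₁) (Module.Dual k E₂)) (v : E₂)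
    (W : Tree k E₁ E₂ ⊗[k] Tree k E₁ E₂) (A : Tree k E₁ E₂) :
    pairing₂ (unT k f X) Y (binCutL k (v ⊗ₜ (W ⊗ₜ A))) = 0 := by
  induction W with
  | zero => simp
  | add W W' h h' =>
    simp only [TensorProduct.add_tmul, TensorProduct.tmul_add, map_add, h, h', add_zero]
  | tmul Z Z' => simp [binCutL_tmul, pairing_unT_binT]

theorem pairing₂_binCutR_of_un (f : Module.Dual k E₁)
    (X Y : Tree k (Module.Dual k E₁) (Module.Dual k E₂)) (v : E₂)
    (A : Tree k E₁ E₂) (W : Tree k E₁ E₂ ⊗[k] Tree k E₁ E₂) :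
    pairing₂ (unT k f X) Y (binCutR k (v ⊗ₜ (A ⊗ₜ W))) = 0 := by
  induction W with
  | zero => simp
  | add W W' h h' => simp only [TensorProduct.tmul_add, map_add, h, h', add_zero]
  | tmul Z Z' => simp [binCutR_tmul, pairing_unT_binT]

theorem pairing₂_binCutL_of_leaf (Y : Tree k (Module.Dual k E₁) (Module.Dual k E₂)) (v : E₂)
    (W : Tree k E₁ E₂ ⊗[k] Tree k E₁ E₂) (A : Tree k E₁ E₂) :
    pairing₂ (leafT k) Y (binCutL k (v ⊗ₜ (W ⊗ₜ A))) = 0 := by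
  induction W with
  | zero => simp
  | add W W' h h' =>
    simp only [TensorProduct.add_tmul, TensorProduct.tmul_add, map_add, h, h', add_zero]
  | tmul Z Z' => simp [binCutL_tmul, pairing_leafT_binT]

theorem pairing₂_binCutR_of_leaf (Y : Tree k (Module.Dual k E₁) (Module.Dual k E₂)) (v : E₂)
    (A : Tree k E₁ E₂) (W : Tree k E₁ E₂ ⊗[k] Tree k E₁ E₂) :
    pairing₂ (leafT k) Y (binCutR k (v ⊗ₜ (A ⊗ₜ W))) = 0 := by
  induction W with
  | zero => simp
  | add W W' h h' => simp only [TensorProduct.tmul_add, map_add, h, h', add_zero]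
  | tmul Z Z' => simp [binCutR_tmul, pairing_leafT_binT]

theorem pairing₂_binCutL_of_bin {m n : ℕ} {d e : ℤ} (f : Module.Dual k E₂)
    {X X' : Tree k (Module.Dual k E₁) (Module.Dual k E₂)} (hX : X ∈ piece k (-1) 0 m d)
    (hX' : X' ∈ piece k (-1) 0 n e) (Y : Tree k (Module.Dual k E₁) (Module.Dual k E₂)) (v : E₂)
    (W : Tree k E₁ E₂ ⊗[k] Tree k E₁ E₂) (A : Tree k E₁ E₂) :
    pairing₂ (binT k f X X') Y (binCutL k (v ⊗ₜ (W ⊗ₜ A))) =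
      sgn k ((m : ℤ) - 1 + d * (-e + (n : ℤ) - 1)) *
        (f v * (pairing₂ X Y W * pairing k X' A)) := by
  induction W with
  | zero => simp
  | add W W' h h' =>
    simp only [TensorProduct.add_tmul, TensorProduct.tmul_add, map_add, h, h']; ring
  | tmul Z Z' =>
    simp only [binCutL_tmul, TensorProduct.dualDistrib_apply, pairing_binT_binT f hX hX']
    ring

theorem pairing₂_binCutR_of_bin {m n : ℕ} {d e : ℤ} (f : Module.Dual k E₂)
    {X X' : Tree k (Module.Dual k E₁) (Module.Dual k E₂)} (hX : X ∈ piece k (-1) 0 m d)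
    (hX' : X' ∈ piece k (-1) 0 n e) (Y : Tree k (Module.Dual k E₁) (Module.Dual k E₂)) (v : E₂)
    (A : Tree k E₁ E₂) (W : Tree k E₁ E₂ ⊗[k] Tree k E₁ E₂) :
    pairing₂ (binT k f X X') Y (binCutR k (v ⊗ₜ (A ⊗ₜ W))) =
      sgn k ((m : ℤ) - 1 + d * (-e + (n : ℤ) - 1)) *
        (f v * (pairing k X A * pairing₂ X' Y W)) := by
  induction W with
  | zero => simp
  | add W W' h h' => simp only [TensorProduct.tmul_add, map_add, h, h']; ring
  | tmul Z Z' =>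
    simp only [binCutR_tmul, TensorProduct.dualDistrib_apply, pairing_binT_binT f hX hX']
    ring

/-- The sign of `∘ᵢ` in `(𝒮ᶜ ⊗_H C)*`, for arguments of arities `m, n` and degrees `d, e`. -/
def circSgn (k : Type u) [Field k] (m n : ℕ) (d e : ℤ) (i : ℕ) : k :=
  sgn k (e * -d) *
    (sgn k (((i : ℤ) - 1) * (1 - (n : ℤ))) * sgn k ((1 - (n : ℤ)) * (-d + (m : ℤ) - 1)))

/-- Signs depend on exponents modulo 2, so each sign identity below becomes a polynomial identity
over the field with two elements, settled by trying all values. -/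
theorem sgn_eq_of_cast {a b : ℤ} (h : (a : ZMod 2) = b) : sgn k a = sgn k b := by
  have h' : Even (a - b) := by
    rw [← ZMod.intCast_eq_zero_iff_even, Int.cast_sub, h, sub_self]
  rw [← sub_add_cancel a b, sgn_add, sgn, Int.negOnePow_even _ h']
  simp

/-- The identity tree pairs to zero with every tree that has a vertex, so only the trivial cut at
the root survives. This is the base case of the adjunction. -/
theorem pairing₂_cut_leaf (i : ℕ) (e : ℤ) (Y : Tree k (Module.Dual k E₁) (Module.Dual k E₂))
    (C : Tree k E₁ E₂) :
    pairing₂ (leafT k) Y (cut k 1 1 e i C) = if i = 1 then pairing k Y C else 0 := by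
  refine tree_cases (p := fun C =>
    pairing₂ (leafT k) Y (cut k 1 1 e i C) = if i = 1 then pairing k Y C else 0) (by simp)
    ?_ ?_ ?_ ?_ C
  · intro C C' h h'
    simp only [map_add, h, h']
    split_ifs <;> simp
  · intro c
    rw [map_smul, cut_leafT]
    split_ifs <;> simp [pairing_leafT_leafT]
  · intro v t x
    rw [cut_unT, map_add, pairing₂_unCut_of_leaf]
    split_ifs <;> simp [pairing_leafT_leafT]
  · intro v l r x y
    rw [cut_binT]
    simp only [map_add, map_smul, pairing₂_binCutL_of_leaf]
    split_ifs <;> simp [pairing_leafT_leafT, pairing₂_binCutR_of_leaf]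

/-- The compatibility that the signs of `shapePairing` have to satisfy for the adjunction to pass
through a unary root: on the left the sign of the grafted tree, on the right that of the original
tree. The bound on `n` makes the truncated subtraction in the arity of the composite harmless. -/
theorem circSgn_un (t : Shape) {n : ℕ} (e : ℤ) (i : ℕ) (hn : 1 ≤ n) :
    sgn k (-(t.degree (-1) 0 + e) + ((t.arity + n - 1 : ℕ) : ℤ) - 1) *
      circSgn k t.arity n (t.degree (-1) 0) e i =
      circSgn k (Shape.un t).arity n ((Shape.un t).degree (-1) 0) e i *
      sgn k (-t.degree (-1) 0 + (t.arity : ℤ) - 1) := by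
  have hN : ((t.arity + n - 1 : ℕ) : ℤ) = t.arity + n - 1 := by omega
  simp only [circSgn, Shape.degree, Shape.arity, ← sgn_add, hN]
  refine sgn_eq_of_cast ?_
  push_cast
  generalize (t.degree (-1) 0 : ZMod 2) = d
  generalize (t.arity : ZMod 2) = m
  generalize (e : ZMod 2) = e
  generalize (n : ZMod 2) = n
  generalize (i : ZMod 2) = i
  revert d m e n i
  decide

/-- The same compatibility for a binary root when the grafting takes place in the left subtree. The
first factor on the left is the Koszul sign of grafting past `r`, in degrees (-1, 0); the middle
factor on the right is that of cutting past `r`, in degrees (1, 1). -/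
theorem circSgn_bin_left (l r : Shape) {n : ℕ} (e : ℤ) (i : ℕ) (hn : 1 ≤ n) :
    sgn k (r.degree (-1) 0 * e) * sgn k (((l.arity + n - 1 : ℕ) : ℤ) - 1 +
      (l.degree (-1) 0 + e) * (-r.degree (-1) 0 + (r.arity : ℤ) - 1)) *
      circSgn k l.arity n (l.degree (-1) 0) e i =
      circSgn k (Shape.bin l r).arity n ((Shape.bin l r).degree (-1) 0) e i *
      sgn k (r.degree 1 1 * (-e + (n : ℤ) - 1)) *
      sgn k ((l.arity : ℤ) - 1 +
      l.degree (-1) 0 * (-r.degree (-1) 0 + (r.arity : ℤ) - 1)) := by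
  have hN : ((l.arity + n - 1 : ℕ) : ℤ) = l.arity + n - 1 := by omega
  simp only [circSgn, r.degree_one_one, ← sgn_add, hN]
  simp only [Shape.degree, Shape.arity]
  refine sgn_eq_of_cast ?_
  push_cast
  generalize (r.degree (-1) 0 : ZMod 2) = d'
  generalize (l.degree (-1) 0 : ZMod 2) = d
  generalize (l.arity : ZMod 2) = m
  generalize (r.arity : ZMod 2) = m'
  generalize (e : ZMod 2) = e
  generalize (n : ZMod 2) = n
  generalize (i : ZMod 2) = i
  revert d d' m m' e n i
  decide

/-- In the right subtree nothing after the leaf is passed at this root, so neither grafting nor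
cutting adds a Koszul sign; the index shift by the arity of `l` has to be absorbed instead. -/
theorem circSgn_bin_right (l r : Shape) {n : ℕ} (e : ℤ) {i : ℕ} (hn : 1 ≤ n) (hi : l.arity ≤ i) :
    sgn k ((l.arity : ℤ) - 1 + l.degree (-1) 0 *
      (-(r.degree (-1) 0 + e) + ((r.arity + n - 1 : ℕ) : ℤ) - 1)) *
      circSgn k r.arity n (r.degree (-1) 0) e (i - l.arity) =
      circSgn k (Shape.bin l r).arity n ((Shape.bin l r).degree (-1) 0) e i *
      sgn k ((l.arity : ℤ) - 1 +
      l.degree (-1) 0 * (-r.degree (-1) 0 + (r.arity : ℤ) - 1)) := by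
  have hN : ((r.arity + n - 1 : ℕ) : ℤ) = r.arity + n - 1 := by omega
  have hI : ((i - l.arity : ℕ) : ℤ) = i - l.arity := by omega
  simp only [circSgn, ← sgn_add, hN, hI]
  simp only [Shape.degree, Shape.arity]
  refine sgn_eq_of_cast ?_
  push_cast
  generalize (r.degree (-1) 0 : ZMod 2) = d'
  generalize (l.degree (-1) 0 : ZMod 2) = d
  generalize (l.arity : ZMod 2) = m
  generalize (r.arity : ZMod 2) = m'
  generalize (e : ZMod 2) = e
  generalize (n : ZMod 2) = n
  generalize (i : ZMod 2) = i
  revert d d' m m' e n i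
  decide

set_option maxHeartbeats 800000 in
/-- Grafting is dual to cutting. -/
theorem pairing_graft_ofShape {n : ℕ} {e : ℤ} {Y : Tree k (Module.Dual k E₁) (Module.Dual k E₂)}
    (hY : Y ∈ piece k (-1) 0 n e) (hn : 1 ≤ n) (s : Shape)
    (x : Dec k (Module.Dual k E₁) (Module.Dual k E₂) s) (i : ℕ) (hi : 1 ≤ i) (C : Tree k E₁ E₂) :
    pairing k (graft k (-1) 0 e i (ofShape k s x) Y) C =
      circSgn k s.arity n (s.degree (-1) 0) e i *
        pairing₂ (ofShape k s x) Y (cut k 1 1 (-e + (n : ℤ) - 1) i C) := by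
  refine shape_induction (p := fun s X => ∀ i, 1 ≤ i → ∀ C : Tree k E₁ E₂,
    pairing k (graft k (-1) 0 e i X Y) C =
      circSgn k s.arity n (s.degree (-1) 0) e i *
        pairing₂ X Y (cut k 1 1 (-e + (n : ℤ) - 1) i C)) ?_ ?_ ?_ ?_ ?_ s x i hi C
  · intro s i hi C
    rw [pairing₂_zero]
    simp
  · intro s X X' h h' i hi C
    rw [pairing₂_add, map_add, LinearMap.add_apply, map_add, LinearMap.add_apply, h i hi, h' i hi]
    ring
  · intro c i hi C
    rw [pairing₂_smul, pairing₂_cut_leaf, map_smul, LinearMap.smul_apply, graft_leafT]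
    split_ifs with h1
    · subst h1
      simp [circSgn, Shape.degree, Shape.arity, sgn_zero]
    · simp
  · intro t f x ih i hi C
    have hx := ofShape_mem k (-1) 0 t x
    rw [graft_ofShape_un]
    have hg := graft_mem_of_pos (N := t.arity + n - 1) hi (by omega) rfl hx hY
    refine tree_cases (p := fun C => _ = _ * pairing₂ _ Y (cut k 1 1 (-e + (n : ℤ) - 1) i C))
      (by simp) ?_ ?_ ?_ ?_ C
    · intro C C' h h'
      simp only [map_add, h, h', mul_add]
    · intro c
      rw [map_smul, map_smul, pairing_unT_leafT, cut_leafT]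
      split_ifs <;> simp [pairing_unT_leafT]
    · intro v t' y
      rw [pairing_unT_unT f hg, ih i hi, cut_unT, map_add, pairing₂_unCut_of_un f hx]
      -- The trivial cut has the identity as its root factor, which is orthogonal to trees with a
      -- unary root.
      have h0 : pairing₂ (unT k f (ofShape k t x)) Y
          (if i = 1 then leafT k ⊗ₜ unT k v (ofShape k t' y) else 0) = 0 := by
        split_ifs <;> simp [pairing_unT_leafT]
      rw [h0, zero_add]
      have key := circSgn_un (k := k) t e i hn
      linear_combination (f v * pairing₂ (ofShape k t x) Y
        (cut k 1 1 (-e + (n : ℤ) - 1) i (ofShape k t' y))) * key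
    · intro v l r y z
      rw [pairing_unT_binT, cut_binT]
      simp only [map_add, map_smul, pairing₂_binCutL_of_un]
      split_ifs <;> simp [pairing_unT_leafT, pairing₂_binCutR_of_un]
  · intro l r f x x' ihl ihr i hi C
    have hx := ofShape_mem k (-1) 0 l x
    have hx' := ofShape_mem k (-1) 0 r x'
    rw [graft_ofShape_bin]
    refine tree_cases (p := fun C => _ = _ * pairing₂ _ Y (cut k 1 1 (-e + (n : ℤ) - 1) i C))
      (by simp) ?_ ?_ ?_ ?_ C
    · intro C C' h h'
      simp only [map_add, h, h', mul_add]
    · intro c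
      rw [map_smul, map_smul, cut_leafT]
      split_ifs <;> simp [pairing_binT_leafT]
    · intro v t y
      rw [cut_unT, map_add, pairing₂_unCut_of_bin]
      split_ifs <;> simp [pairing_binT_unT, pairing_binT_leafT]
    · intro v l' r' y z
      have h0 : pairing₂ (binT k f (ofShape k l x) (ofShape k r x')) Y
          (if i = 1 then leafT k ⊗ₜ binT k v (ofShape k l' y) (ofShape k r' z) else 0) = 0 := by
        split_ifs <;> simp [pairing_binT_leafT]
      rw [cut_binT, map_add, map_add, h0, zero_add, map_smul, pairing₂_binCutL_of_bin f hx hx',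
        apply_ite (pairing₂ _ Y), pairing₂_binCutR_of_bin f hx hx', map_zero, smul_eq_mul]
      by_cases h : i ≤ l.arity
      · have hg := graft_mem_of_pos (N := l.arity + n - 1) hi (by omega) rfl hx hY
        -- Cuts in the right subtree do not contribute: they need `l'.arity < i ≤ l.arity`, hence `l
        -- ≠ l'`, and then the left subtrees pair to zero.
        have h1 : (if l'.arity < i then sgn k ((l.arity : ℤ) - 1 + l.degree (-1) 0 *
            (-r.degree (-1) 0 + (r.arity : ℤ) - 1)) * (f v * (pairing k (ofShape k l x) (ofShape k l' y) *
            pairing₂ (ofShape k r x') Y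
              (cut k 1 1 (-e + (n : ℤ) - 1) (i - l'.arity) (ofShape k r' z)))) else 0) = 0 := by
          split_ifs with h2
          · rw [pairing_ofShape_of_ne k (by rintro rfl; omega)]
            simp
          · rfl
        rw [h1, add_zero, if_pos h, map_smul, LinearMap.smul_apply, pairing_binT_binT f hg hx',
          ihl i hi, smul_eq_mul]
        -- The cutting sign involves `r'` and the sign identity involves `r`; if they differ, both
        -- sides vanish.
        by_cases h2 : r = r'
        · subst h2
          have key := circSgn_bin_left (k := k) l r e i hn
          linear_combination (f v * pairing₂ (ofShape k l x) Y
            (cut k 1 1 (-e + (n : ℤ) - 1) i (ofShape k l' y)) *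
            pairing k (ofShape k r x') (ofShape k r z)) * key
        · rw [pairing_ofShape_of_ne k h2]
          simp
      · have hg := graft_mem_of_pos (i := i - l.arity) (N := r.arity + n - 1) (by omega)
          (by omega) rfl hx' hY
        -- Here `i` exceeds the arity of `l`, so grafting on `x` gives zero; by the induction
        -- hypothesis and invertibility of the sign, the left cuts do not contribute.
        have h1 : pairing₂ (ofShape k l x) Y
            (cut k 1 1 (-e + (n : ℤ) - 1) i (ofShape k l' y)) = 0 := by
          have h2 := ihl i hi (ofShape k l' y)
          rw [graft_eq_zero (by omega) hx, map_zero, LinearMap.zero_apply] at h2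
          refine (mul_eq_zero.1 h2.symm).resolve_left ?_
          rw [circSgn, ← sgn_add, ← sgn_add]
          exact left_ne_zero_of_mul_eq_one (sgn_mul_self k _)
        rw [h1, if_neg h, pairing_binT_binT f hx hg, ihr _ (by omega)]
        by_cases h2 : l = l'
        · subst h2
          rw [if_pos (by omega)]
          have key := circSgn_bin_right (k := k) l r e (i := i) hn (by omega)
          linear_combination (f v * pairing k (ofShape k l x) (ofShape k l y) *
            pairing₂ (ofShape k r x') Y
              (cut k 1 1 (-e + (n : ℤ) - 1) (i - l.arity) (ofShape k r' z))) * key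
        · rw [pairing_ofShape_of_ne k h2]
          simp

/-- The sign depends only on arities, degrees and the index, so the statement for single shapes
extends linearly. Arity `n = 0` is separate: there are no trees without leaves, so `Y = 0`. -/
theorem pairing_graft {m n : ℕ} {d e : ℤ} {X Y : Tree k (Module.Dual k E₁) (Module.Dual k E₂)}
    (hX : X ∈ piece k (-1) 0 m d) (hY : Y ∈ piece k (-1) 0 n e) (i : ℕ) (hi : 1 ≤ i)
    (C : Tree k E₁ E₂) :
    pairing k (graft k (-1) 0 e i X Y) C =
      circSgn k m n d e i * pairing₂ X Y (cut k 1 1 (-e + (n : ℤ) - 1) i C) := by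
  rcases Nat.eq_zero_or_pos n with rfl | hn
  · rw [eq_zero_of_mem_piece_zero hY, pairing₂, map_zero (pairing k), TensorProduct.tmul_zero]
    simp
  refine piece_induction (p := fun X => pairing k (graft k (-1) 0 e i X Y) C =
      circSgn k m n d e i * pairing₂ X Y (cut k 1 1 (-e + (n : ℤ) - 1) i C)) ?_ ?_ ?_ hX
  · rw [pairing₂_zero]
    simp
  · intro X X' h h'
    rw [pairing₂_add, map_add, LinearMap.add_apply, map_add, LinearMap.add_apply, h, h']
    ring
  · rintro s x rfl rfl
    exact pairing_graft_ofShape hY hn s x i hi C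

end GraftCut

/-! ### Detecting `K ⊗ L` by functionals -/

section LinearAlgebra

variable {k : Type u} [Field k]

theorem dualDistrib_bijective (V W : Type u) [AddCommGroup V] [Module k V] [FiniteDimensional k V]
    [AddCommGroup W] [Module k W] [FiniteDimensional k W] :
    Function.Bijective (TensorProduct.dualDistrib k V W) :=
  (TensorProduct.dualDistribEquiv k V W).bijective

/-- A tensor lies in `K ⊗ L` if it is killed by all `f ⊗ g` such that `f` vanishes on `K` or `g`
vanishes on `L`. -/
theorem mem_range_mapIncl {V W : Type u} [AddCommGroup V] [Module k V] [FiniteDimensional k V]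
    [AddCommGroup W] [Module k W] [FiniteDimensional k W] (K : Submodule k V) (L : Submodule k W)
    (z : V ⊗[k] W)
    (hK : ∀ f ∈ K.dualAnnihilator, ∀ g, TensorProduct.dualDistrib k V W (f ⊗ₜ g) z = 0)
    (hL : ∀ f, ∀ g ∈ L.dualAnnihilator, TensorProduct.dualDistrib k V W (f ⊗ₜ g) z = 0) :
    z ∈ LinearMap.range (TensorProduct.mapIncl K L) := by
  obtain ⟨p, hp⟩ := K.subtype.exists_leftInverse_of_injective K.ker_subtype
  obtain ⟨q, hq⟩ := L.subtype.exists_leftInverse_of_injective L.ker_subtype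
  -- With retractions `p`, `q` onto the subspaces, the only possible preimage is `(p ⊗ q) z`.
  -- Whether it maps to `z` is tested on functionals `f ⊗ g`.
  refine ⟨TensorProduct.map p q z, ?_⟩
  rw [← sub_eq_zero, ← Module.forall_dual_apply_eq_zero_iff k]
  intro φ
  obtain ⟨w, rfl⟩ := (dualDistrib_bijective V W).2 φ
  induction w with
  | zero => simp
  | add w w' h h' => rw [map_add, LinearMap.add_apply, h, h', add_zero]
  | tmul f g =>
    have h1 : ∀ z, TensorProduct.dualDistrib k V W (f ⊗ₜ g) (TensorProduct.mapIncl K L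
        (TensorProduct.map p q z)) = TensorProduct.dualDistrib k V W
          ((f ∘ₗ K.subtype ∘ₗ p) ⊗ₜ (g ∘ₗ L.subtype ∘ₗ q)) z := fun z => by
      induction z with
      | zero => simp
      | add a b ha hb => simp only [map_add, ha, hb]
      | tmul a b => simp
    -- With `f' = f ∘ p` and `g' = g ∘ q`, one has `f ⊗ g - f' ⊗ g' = (f - f') ⊗ g + f' ⊗ (g - g')`,
    -- where `f - f'` vanishes on `K` and `g - g'` on `L`.
    have h2 := hK (f - f ∘ₗ K.subtype ∘ₗ p) (by
      rw [Submodule.mem_dualAnnihilator]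
      intro v hv
      have := LinearMap.congr_fun hp ⟨v, hv⟩
      simp only [LinearMap.comp_apply, Submodule.subtype_apply, LinearMap.id_apply] at this
      simp [this]) g
    have h3 := hL (f ∘ₗ K.subtype ∘ₗ p) (g - g ∘ₗ L.subtype ∘ₗ q) (by
      rw [Submodule.mem_dualAnnihilator]
      intro v hv
      have := LinearMap.congr_fun hq ⟨v, hv⟩
      simp only [LinearMap.comp_apply, Submodule.subtype_apply, LinearMap.id_apply] at this
      simp [this])
    rw [TensorProduct.sub_tmul, map_sub, LinearMap.sub_apply] at h2
    rw [TensorProduct.tmul_sub, map_sub, LinearMap.sub_apply] at h3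
    rw [map_sub, h1]
    linear_combination -h2 - h3

end LinearAlgebra

/-! ### The pairing is perfect in each arity and degree -/

section Perfect

variable {k : Type u} [Field k]
variable {E₁ E₂ : Type u} [AddCommGroup E₁] [Module k E₁] [AddCommGroup E₂] [Module k E₂]

theorem proj_of_mem {a₁ a₂ d : ℤ} {n : ℕ} {X : Tree k E₁ E₂} (hX : X ∈ piece k a₁ a₂ n d) :
    proj k a₁ a₂ n d X = ⟨X, hX⟩ := by
  refine Subtype.ext (DFinsupp.ext fun s => (DFinsupp.filter_apply _ _ _).trans ?_)
  split_ifs with h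
  · rfl
  · exact (hX s h).symm

/-- A tree with at most `N + 1` vertices is trivial or a root carrying one or two trees with at most
`N` vertices. -/
theorem Shape.finite_degree_le (N : ℕ) : {s : Shape | s.degree 1 1 ≤ N}.Finite := by
  have h0 : ∀ s : Shape, 0 ≤ s.degree 1 1 := by
    intro s
    induction s with
    | leaf => exact le_rfl
    | un t ih => simp only [Shape.degree]; omega
    | bin l r ihl ihr => simp only [Shape.degree]; omega
  induction N with
  | zero =>
    refine (Set.finite_singleton Shape.leaf).subset fun s hs => ?_
    cases s with
    | leaf => rfl
    | un t => have := h0 t; simp only [Shape.degree, Set.mem_ofPred_eq] at hs; omega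
    | bin l r =>
      have := h0 l
      have := h0 r
      simp only [Shape.degree, Set.mem_ofPred_eq] at hs
      omega
  | succ N ih =>
    refine ((Set.finite_singleton Shape.leaf).union
      ((ih.image Shape.un).union (ih.image2 Shape.bin ih))).subset fun s hs => ?_
    cases s with
    | leaf => exact Or.inl rfl
    | un t =>
      refine Or.inr (Or.inl ⟨t, ?_, rfl⟩)
      simp only [Shape.degree, Set.mem_ofPred_eq] at hs ⊢
      omega
    | bin l r =>
      have := h0 l
      have := h0 r
      refine Or.inr (Or.inr ⟨l, ?_, r, ?_, rfl⟩) <;>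
      · simp only [Shape.degree, Set.mem_ofPred_eq] at hs ⊢
        omega

theorem Shape.finite_degree_eq (d : ℤ) : {s : Shape | s.degree 1 1 = d}.Finite :=
  (Shape.finite_degree_le d.toNat).subset fun s hs => by
    simp only [Set.mem_ofPred_eq] at hs ⊢
    omega

/-- The pairing as a map from a component of `𝒯(E*)` to the dual of a component of `𝒯ᶜ(sE)`. -/
def piecePairing (n : ℕ) (d w : ℤ) :
    piece k (E₁ := Module.Dual k E₁) (E₂ := Module.Dual k E₂) (-1) 0 n d →ₗ[k]
      Module.Dual k (piece k (E₁ := E₁) (E₂ := E₂) 1 1 n w) :=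
  (piece k 1 1 n w).subtype.dualMap ∘ₗ pairing k ∘ₗ (piece k (-1) 0 n d).subtype

theorem piecePairing_apply (n : ℕ) (d w : ℤ)
    (X : piece k (E₁ := Module.Dual k E₁) (E₂ := Module.Dual k E₂) (-1) 0 n d)
    (Y : piece k (E₁ := E₁) (E₂ := E₂) 1 1 n w) :
    piecePairing n d w X Y = pairing k X.1 Y.1 := rfl

variable [FiniteDimensional k E₁] [FiniteDimensional k E₂]

instance finiteDimensional_dec (s : Shape) : FiniteDimensional k (Dec k E₁ E₂ s) := by
  induction s with
  | leaf => exact inferInstanceAs (FiniteDimensional k k)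
  | un t ih => exact inferInstanceAs (FiniteDimensional k (E₁ ⊗[k] Dec k E₁ E₂ t))
  | bin l r ihl ihr =>
    exact inferInstanceAs (FiniteDimensional k (E₂ ⊗[k] (Dec k E₁ E₂ l ⊗[k] Dec k E₁ E₂ r)))

instance finiteDimensional_piece (n : ℕ) (d : ℤ) :
    FiniteDimensional k (piece k (E₁ := E₁) (E₂ := E₂) 1 1 n d) := by
  have := (Shape.finite_degree_eq d).to_subtype
  refine Submodule.finiteDimensional_of_le (S₂ := ⨆ s : {s : Shape | s.degree 1 1 = d},
    LinearMap.range (ofShape k (E₁ := E₁) (E₂ := E₂) s)) fun X hX => ?_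
  refine piece_induction (p := fun X => X ∈ ⨆ s : {s : Shape | s.degree 1 1 = d},
    LinearMap.range (ofShape k (E₁ := E₁) (E₂ := E₂) s)) (zero_mem _)
    (fun _ _ => add_mem) (fun s x _ hs => ?_) hX
  exact Submodule.mem_iSup_of_mem (⟨s, hs⟩ : {s : Shape | s.degree 1 1 = d}) ⟨x, rfl⟩

theorem sgn_smul_bijective {V W : Type u} [AddCommGroup V] [Module k V] [AddCommGroup W]
    [Module k W] (a : ℤ) {f : V →ₗ[k] W} (hf : Function.Bijective f) :
    Function.Bijective (sgn k a • f) := by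
  have h := left_ne_zero_of_mul_eq_one (sgn_mul_self k a)
  exact (LinearEquiv.smulOfNeZero k W _ h).bijective.comp hf

/-- Up to invertible signs, this iterates the isomorphism `V* ⊗ W* ≅ (V ⊗ W)*` for
finite-dimensional spaces. -/
theorem shapePairing_bijective (s : Shape) :
    Function.Bijective (shapePairing k (E₁ := E₁) (E₂ := E₂) s) := by
  induction s with
  | leaf =>
    rw [shapePairing]
    exact ((decLeaf k (Module.Dual k E₁) (Module.Dual k E₂)).trans
      ((LinearMap.ringLmapEquivSelf k k k).symm.trans (decLeaf k E₁ E₂).dualMap)).bijective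
  | un t ih =>
    rw [shapePairing]
    refine sgn_smul_bijective _ ((decUn k E₁ E₂ t).dualMap.bijective.comp
      ((dualDistrib_bijective _ _).comp (Function.Bijective.comp ?_ (decUn k _ _ t).bijective)))
    exact (TensorProduct.congr (LinearEquiv.refl k _) (LinearEquiv.ofBijective _ ih)).bijective
  | bin l r ihl ihr =>
    rw [shapePairing]
    refine sgn_smul_bijective _ ((decBin k E₁ E₂ l r).dualMap.bijective.comp
      ((dualDistrib_bijective _ _).comp (Function.Bijective.comp ?_ (decBin k _ _ l r).bijective)))
    exact (TensorProduct.congr (LinearEquiv.refl k _) ((TensorProduct.congr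
      (LinearEquiv.ofBijective _ ihl) (LinearEquiv.ofBijective _ ihr)).trans
      (TensorProduct.dualDistribEquiv k _ _))).bijective

theorem piecePairing_injective (n : ℕ) (d : ℤ) :
    Function.Injective (piecePairing (k := k) (E₁ := E₁) (E₂ := E₂) n d (-d + (n : ℤ) - 1)) := by
  rw [← LinearMap.ker_eq_bot, LinearMap.ker_eq_bot']
  intro X hX
  refine Subtype.ext (DFinsupp.ext fun s => ?_)
  by_cases h : s.arity = n ∧ s.degree (-1) 0 = d
  · obtain ⟨rfl, rfl⟩ := h
    refine (shapePairing_bijective s).1 ?_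
    change shapePairing k s (X.1 s) = shapePairing k s 0
    rw [map_zero]
    refine LinearMap.ext fun y => ?_
    -- Testing against trees of the single shape `s` isolates the component of `X` at `s`.
    have h1 := LinearMap.congr_fun hX ⟨ofShape k s y, s.degree_one_one ▸ ofShape_mem k 1 1 s y⟩
    rw [piecePairing_apply] at h1
    have h2 : ∀ Z : Tree k (Module.Dual k E₁) (Module.Dual k E₂),
        shapePairing k s (Z s) y = pairing k Z (ofShape k s y) := fun Z => by
      refine tree_induction (p := fun Z => shapePairing k s (Z s) y = pairing k Z (ofShape k s y))
        (by simp) (fun A B hA hB => by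
          rw [DirectSum.add_apply, map_add, map_add, LinearMap.add_apply, LinearMap.add_apply,
            hA, hB]) (fun t z => ?_) Z
      by_cases h : t = s
      · subst h
        rw [pairing_ofShape_self, ofShape, DirectSum.lof_apply]
      · rw [pairing_ofShape_of_ne k h, ofShape, DirectSum.lof_eq_of,
          DirectSum.of_eq_of_ne _ _ _ (Ne.symm h), map_zero, LinearMap.zero_apply]
    exact (h2 _).trans h1
  · exact X.2 s h

theorem piecePairing_surjective (n : ℕ) (d : ℤ) :
    Function.Surjective (piecePairing (k := k) (E₁ := E₁) (E₂ := E₂) n d (-d + (n : ℤ) - 1)) := by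
  intro f
  let S := (Shape.finite_degree_eq (-d + (n : ℤ) - 1)).toFinset.filter fun s => s.arity = n
  have hS : ∀ s, s ∈ S ↔ s.degree 1 1 = -d + (n : ℤ) - 1 ∧ s.arity = n := by simp [S]
  -- The functional is represented shape by shape; only the finitely many shapes in `S` occur in
  -- this arity and weight.
  choose g hg using fun s => (shapePairing_bijective (k := k) (E₁ := E₁) (E₂ := E₂) s).2
    (f ∘ₗ proj k 1 1 n _ ∘ₗ ofShape k s)
  refine ⟨⟨∑ s ∈ S, ofShape k s (g s), Submodule.sum_mem _ fun s hs => ?_⟩, ?_⟩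
  · obtain ⟨h1, rfl⟩ := (hS s).1 hs
    have h2 : s.degree (-1) 0 = d := by
      have := s.degree_one_one
      omega
    exact h2 ▸ ofShape_mem k (-1) 0 s (g s)
  · refine LinearMap.ext fun Y => ?_
    rw [piecePairing_apply, show f Y = f (proj k 1 1 n _ Y.1) by rw [proj_of_mem Y.2]]
    refine piece_induction (p := fun Y => pairing k (∑ s ∈ S, ofShape k s (g s)) Y =
      f (proj k 1 1 n _ Y)) (by simp) (fun A B hA hB => by rw [map_add, map_add, map_add, hA, hB])
      (fun t y ht ht' => ?_) Y.2
    rw [map_sum, LinearMap.sum_apply, Finset.sum_eq_single t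
      (fun s _ hs => pairing_ofShape_of_ne k hs _ _)
      (fun h => absurd ((hS t).2 ⟨ht', ht⟩) h), pairing_ofShape_self, hg]
    rfl

end Perfect

/-! ### The pairing in weight two -/

section Relations

variable {k : Type u} [Field k]
variable {E₁ E₂ : Type u} [AddCommGroup E₁] [Module k E₁] [AddCommGroup E₂] [Module k E₂]

theorem quadTree₁_tmul (a b : E₁) :
    quadTree₁ k (a ⊗ₜ b) = (unT k a (unT k b (leafT k)) : Tree k E₁ E₂) := by
  simp [quadTree₁, unU, corolla₁]

theorem quadTree₂_inl (a : E₁) (b : E₂) :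
    quadTree₂ k (a ⊗ₜ b, 0) = unT k a (binT k b (leafT k) (leafT k)) := by
  simp [quadTree₂, unU, corolla₂]

theorem quadTree₂_mid (a : E₂) (b : E₁) :
    quadTree₂ k (0, a ⊗ₜ b, 0) = binT k a (unT k b (leafT k)) (leafT k) := by
  simp [quadTree₂, binU, corolla₁]

theorem quadTree₂_inr (a : E₂) (b : E₁) :
    quadTree₂ k (0, 0, a ⊗ₜ b) = binT k a (leafT k) (unT k b (leafT k)) := by
  simp [quadTree₂, binU, corolla₁]

theorem quadTree₃_inl (a b : E₂) :
    quadTree₃ k (a ⊗ₜ b, 0) =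
      (binT k a (binT k b (leafT k) (leafT k)) (leafT k) : Tree k E₁ E₂) := by
  simp [quadTree₃, binU, corolla₂]

theorem quadTree₃_inr (a b : E₂) :
    quadTree₃ k (0, a ⊗ₜ b) =
      (binT k a (leafT k) (binT k b (leafT k) (leafT k)) : Tree k E₁ E₂) := by
  simp [quadTree₃, binU, corolla₂]

theorem sgn_one : sgn k 1 = -1 := by simp [sgn]

theorem unT_leafT_mem (a₁ a₂ : ℤ) (v : E₁) :
    unT k v (leafT k) ∈ piece k (E₁ := E₁) (E₂ := E₂) a₁ a₂ 1 a₁ := corolla₁_mem a₁ a₂ v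

theorem binT_leafT_mem (a₁ a₂ : ℤ) (v : E₂) :
    binT k v (leafT k) (leafT k) ∈ piece k (E₁ := E₁) (E₂ := E₂) a₁ a₂ 2 a₂ := corolla₂_mem a₁ a₂ v

variable (f : Module.Dual k E₁) (g : Module.Dual k E₂) (f' : Module.Dual k E₁)
  (g' : Module.Dual k E₂) (v : E₁) (w : E₂) (Y Z : Tree k E₁ E₂)

theorem pairing_un_leaf : pairing k (unT k f (leafT k)) (unT k v Y) =
    f v * pairing k (leafT k) Y := by
  simp [pairing_unT_unT f (leafT_mem k (-1) 0), sgn_zero]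

theorem pairing_bin_leaf_leaf : pairing k (binT k g (leafT k) (leafT k)) (binT k w Y Z) =
    g w * (pairing k (leafT k) Y * pairing k (leafT k) Z) := by
  simp [pairing_binT_binT g (leafT_mem k (-1) 0) (leafT_mem k (-1) 0), sgn_zero]

theorem pairing_un_un : pairing k (unT k f (unT k f' (leafT k))) (unT k v Y) =
    -(f v * pairing k (unT k f' (leafT k)) Y) := by
  simp [pairing_unT_unT f (unT_leafT_mem (-1) 0 f'), sgn_one]

theorem pairing_un_bin : pairing k (unT k f (binT k g (leafT k) (leafT k))) (unT k v Y) =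
    -(f v * pairing k (binT k g (leafT k) (leafT k)) Y) := by
  simp [pairing_unT_unT f (binT_leafT_mem (-1) 0 g), sgn_one]

theorem pairing_bin_un_leaf :
    pairing k (binT k g (unT k f (leafT k)) (leafT k)) (binT k w Y Z) =
      g w * (pairing k (unT k f (leafT k)) Y * pairing k (leafT k) Z) := by
  simp [pairing_binT_binT g (unT_leafT_mem (-1) 0 f) (leafT_mem k (-1) 0), sgn_zero]

theorem pairing_bin_leaf_un :
    pairing k (binT k g (leafT k) (unT k f (leafT k))) (binT k w Y Z) =
      g w * (pairing k (leafT k) Y * pairing k (unT k f (leafT k)) Z) := by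
  simp [pairing_binT_binT g (leafT_mem k (-1) 0) (unT_leafT_mem (-1) 0 f), sgn_zero]

theorem pairing_bin_bin_leaf :
    pairing k (binT k g (binT k g' (leafT k) (leafT k)) (leafT k)) (binT k w Y Z) =
      -(g w * (pairing k (binT k g' (leafT k) (leafT k)) Y * pairing k (leafT k) Z)) := by
  simp [pairing_binT_binT g (binT_leafT_mem (-1) 0 g') (leafT_mem k (-1) 0), sgn_one]

theorem pairing_bin_leaf_bin :
    pairing k (binT k g (leafT k) (binT k g' (leafT k) (leafT k))) (binT k w Y Z) =
      g w * (pairing k (leafT k) Y * pairing k (binT k g' (leafT k) (leafT k)) Z) := by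
  simp [pairing_binT_binT g (leafT_mem k (-1) 0) (binT_leafT_mem (-1) 0 g'), sgn_zero]

/-- The sign is that of the weight one of the subtree above the root. In arities one and three the
pairing is minus the prescribed form, in arity two it equals the form; a global sign does not affect
orthogonals. -/
theorem pairing_quadTree₁ (X : Quad₁ k (Module.Dual k E₁)) (r : Quad₁ k E₁) :
    pairing k (quadTree₁ k X : Tree k (Module.Dual k E₁) (Module.Dual k E₂)) (quadTree₁ k r) =
      -TensorProduct.dualDistrib k E₁ E₁ X r := by
  have h : (pairing k (E₁ := E₁) (E₂ := E₂)).compl₁₂ (quadTree₁ k) (quadTree₁ k) =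
      -TensorProduct.dualDistrib k E₁ E₁ := by
    refine TensorProduct.ext' fun a b => TensorProduct.ext' fun v w => ?_
    simp [quadTree₁_tmul, pairing_un_un, pairing_un_leaf, pairing_leafT_leafT]
  exact LinearMap.congr_fun₂ h X r

theorem pairing_quadTree₂ (X : Quad₂ k (Module.Dual k E₁) (Module.Dual k E₂))
    (r : Quad₂ k E₁ E₂) :
    pairing k (quadTree₂ k X) (quadTree₂ k r) =
      - TensorProduct.dualDistrib k E₁ E₂ X.1 r.1
        + TensorProduct.dualDistrib k E₂ E₁ X.2.1 r.2.1
        + TensorProduct.dualDistrib k E₂ E₁ X.2.2 r.2.2 := by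
  have h : (pairing k (E₁ := E₁) (E₂ := E₂)).compl₁₂ (quadTree₂ k) (quadTree₂ k) =
      -(TensorProduct.dualDistrib k E₁ E₂).compl₁₂ (LinearMap.fst k _ _) (LinearMap.fst k _ _)
      + (TensorProduct.dualDistrib k E₂ E₁).compl₁₂
        (LinearMap.fst k _ _ ∘ₗ LinearMap.snd k _ _) (LinearMap.fst k _ _ ∘ₗ LinearMap.snd k _ _)
      + (TensorProduct.dualDistrib k E₂ E₁).compl₁₂
        (LinearMap.snd k _ _ ∘ₗ LinearMap.snd k _ _)
        (LinearMap.snd k _ _ ∘ₗ LinearMap.snd k _ _) := by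
    refine LinearMap.prod_ext (TensorProduct.ext' fun a b => ?_)
      (LinearMap.prod_ext (TensorProduct.ext' fun a b => ?_) (TensorProduct.ext' fun a b => ?_)) <;>
    refine LinearMap.prod_ext (TensorProduct.ext' fun v w => ?_)
      (LinearMap.prod_ext (TensorProduct.ext' fun v w => ?_) (TensorProduct.ext' fun v w => ?_)) <;>
    simp [quadTree₂_inl, quadTree₂_mid, quadTree₂_inr, pairing_un_bin, pairing_bin_un_leaf,
      pairing_bin_leaf_un, pairing_un_leaf, pairing_bin_leaf_leaf, pairing_leafT_leafT,
      pairing_unT_binT, pairing_binT_unT, pairing_leafT_unT, pairing_unT_leafT]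
  exact LinearMap.congr_fun₂ h X r

theorem pairing_quadTree₃ (X : Quad₃ k (Module.Dual k E₂)) (r : Quad₃ k E₂) :
    pairing k (quadTree₃ k X : Tree k (Module.Dual k E₁) (Module.Dual k E₂)) (quadTree₃ k r) =
      -(TensorProduct.dualDistrib k E₂ E₂ X.1 r.1 - TensorProduct.dualDistrib k E₂ E₂ X.2 r.2) := by
  have h : (pairing k (E₁ := E₁) (E₂ := E₂)).compl₁₂ (quadTree₃ k) (quadTree₃ k) =
      -((TensorProduct.dualDistrib k E₂ E₂).compl₁₂ (LinearMap.fst k _ _) (LinearMap.fst k _ _)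
      - (TensorProduct.dualDistrib k E₂ E₂).compl₁₂
        (LinearMap.snd k _ _) (LinearMap.snd k _ _)) := by
    refine LinearMap.prod_ext (TensorProduct.ext' fun a b => ?_)
      (TensorProduct.ext' fun a b => ?_) <;>
    refine LinearMap.prod_ext (TensorProduct.ext' fun v w => ?_)
      (TensorProduct.ext' fun v w => ?_) <;>
    simp [quadTree₃_inl, quadTree₃_inr, pairing_bin_bin_leaf,
      pairing_bin_leaf_bin, pairing_bin_leaf_leaf, pairing_leafT_leafT,
      pairing_leafT_binT, pairing_binT_leafT]
  exact LinearMap.congr_fun₂ h X r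

/-- The subspace of `𝒯(E)^{(2)}` of arity `n`. -/
def quadRange (k : Type u) [Field k] (E₁ E₂ : Type u) [AddCommGroup E₁] [Module k E₁]
    [AddCommGroup E₂] [Module k E₂] (n : ℕ) : Submodule k (Tree k E₁ E₂) :=
  match n with
  | 1 => LinearMap.range (quadTree₁ k)
  | 2 => LinearMap.range (quadTree₂ k)
  | 3 => LinearMap.range (quadTree₃ k)
  | _ => ⊥

/-- Membership is phrased as the vanishing of a linear map to the quotient, so that it can be
checked on pure tensors. -/
theorem quadTree₁_mem (r : Quad₁ k E₁) :
    quadTree₁ k r ∈ piece k (E₁ := E₁) (E₂ := E₂) (-1) 0 1 (-2) := by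
  have h : (piece k (E₁ := E₁) (E₂ := E₂) (-1) 0 1 (-2)).mkQ ∘ₗ quadTree₁ k = 0 := by
    refine TensorProduct.ext' fun a b => ?_
    rw [LinearMap.comp_apply, LinearMap.zero_apply, Submodule.mkQ_apply,
      Submodule.Quotient.mk_eq_zero, quadTree₁_tmul]
    exact unT_mem a (unT_leafT_mem (-1) 0 b)
  exact (Submodule.Quotient.mk_eq_zero _).1 (LinearMap.congr_fun h r)

theorem quadTree₂_mem (r : Quad₂ k E₁ E₂) : quadTree₂ k r ∈ piece k (-1) 0 2 (-1) := by
  have h : (piece k (E₁ := E₁) (E₂ := E₂) (-1) 0 2 (-1)).mkQ ∘ₗ quadTree₂ k = 0 := by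
    refine LinearMap.prod_ext (TensorProduct.ext' fun a b => ?_)
      (LinearMap.prod_ext (TensorProduct.ext' fun a b => ?_) (TensorProduct.ext' fun a b => ?_)) <;>
    refine (Submodule.Quotient.mk_eq_zero _).2 ?_
    · exact quadTree₂_inl (k := k) a b ▸ unT_mem a (binT_leafT_mem (-1) 0 b)
    · exact quadTree₂_mid (k := k) a b ▸
        binT_mem a (unT_leafT_mem (-1) 0 b) (leafT_mem k (-1) 0)
    · exact quadTree₂_inr (k := k) a b ▸
        binT_mem a (leafT_mem k (-1) 0) (unT_leafT_mem (-1) 0 b)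
  exact (Submodule.Quotient.mk_eq_zero _).1 (LinearMap.congr_fun h r)

theorem quadTree₃_mem (r : Quad₃ k E₂) :
    quadTree₃ k r ∈ piece k (E₁ := E₁) (E₂ := E₂) (-1) 0 3 0 := by
  have h : (piece k (E₁ := E₁) (E₂ := E₂) (-1) 0 3 0).mkQ ∘ₗ quadTree₃ k = 0 := by
    refine LinearMap.prod_ext (TensorProduct.ext' fun a b => ?_)
      (TensorProduct.ext' fun a b => ?_) <;>
    refine (Submodule.Quotient.mk_eq_zero _).2 ?_
    · exact quadTree₃_inl (k := k) (E₁ := E₁) a b ▸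
        binT_mem a (binT_leafT_mem (-1) 0 b) (leafT_mem k (-1) 0)
    · exact quadTree₃_inr (k := k) (E₁ := E₁) a b ▸
        binT_mem a (leafT_mem k (-1) 0) (binT_leafT_mem (-1) 0 b)
  exact (Submodule.Quotient.mk_eq_zero _).1 (LinearMap.congr_fun h r)

/-- The degree `n - 3` is the solution of `-d + n - 1 = 2`: relations have two vertices. -/
theorem QuadraticData.relations_le_piece (P : QuadraticData k E₁ E₂) (n : ℕ) :
    P.relations n ≤ piece k (-1) 0 n ((n : ℤ) - 3) := by
  match n with
  | 1 => rintro _ ⟨r, -, rfl⟩; exact quadTree₁_mem r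
  | 2 => rintro _ ⟨r, -, rfl⟩; exact quadTree₂_mem r
  | 3 => rintro _ ⟨r, -, rfl⟩; exact quadTree₃_mem r
  | 0 => exact bot_le
  | n + 4 => exact bot_le

theorem Shape.arity_le_degree (s : Shape) : (s.arity : ℤ) ≤ s.degree 1 1 + 1 := by
  induction s with
  | leaf => simp [Shape.arity, Shape.degree]
  | un t ih => simp only [Shape.arity, Shape.degree]; omega
  | bin l r ihl ihr => simp only [Shape.arity, Shape.degree]; push_cast; omega

/-- Removing the root of a tree with two vertices leaves subtrees of weight zero or one, so these
weights have to be described in the same induction. -/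
theorem ofShape_mem_of_degree_le_two (s : Shape) (x : Dec k E₁ E₂ s) :
    (s.degree 1 1 = 0 → ofShape k s x ∈ Submodule.span k {leafT k}) ∧
    (s.degree 1 1 = 1 → s.arity = 1 → ofShape k s x ∈ LinearMap.range (corolla₁ k)) ∧
    (s.degree 1 1 = 1 → s.arity = 2 → ofShape k s x ∈ LinearMap.range (corolla₂ k)) ∧
    (s.degree 1 1 = 2 → ofShape k s x ∈ quadRange k E₁ E₂ s.arity) := by
  refine shape_induction (p := fun s X =>
    (s.degree 1 1 = 0 → X ∈ Submodule.span k {leafT k}) ∧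
    (s.degree 1 1 = 1 → s.arity = 1 → X ∈ LinearMap.range (corolla₁ k)) ∧
    (s.degree 1 1 = 1 → s.arity = 2 → X ∈ LinearMap.range (corolla₂ k)) ∧
    (s.degree 1 1 = 2 → X ∈ quadRange k E₁ E₂ s.arity)) ?_ ?_ ?_ ?_ ?_ s x
  · exact fun s => ⟨fun _ => zero_mem _, fun _ _ => zero_mem _, fun _ _ => zero_mem _,
      fun _ => zero_mem _⟩
  · exact fun s X Y hX hY => ⟨fun h => add_mem (hX.1 h) (hY.1 h),
      fun h h' => add_mem (hX.2.1 h h') (hY.2.1 h h'),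
      fun h h' => add_mem (hX.2.2.1 h h') (hY.2.2.1 h h'),
      fun h => add_mem (hX.2.2.2 h) (hY.2.2.2 h)⟩
  · intro c
    simp only [Shape.degree, Shape.arity]
    exact ⟨fun _ => Submodule.smul_mem _ _ (Submodule.mem_span_singleton_self _), by simp, by simp,
      by simp⟩
  · intro t v x ih
    have h1 := t.arity_le_degree
    have h2 := t.arity_pos
    simp only [Shape.degree, Shape.arity]
    refine ⟨fun h => by omega, fun h _ => ?_, fun h _ => by omega, fun h => ?_⟩
    · obtain ⟨c, hc⟩ := Submodule.mem_span_singleton.1 (ih.1 (by omega))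
      rw [← hc]
      exact ⟨c • v, by simp [corolla₁]⟩
    · obtain h3 | h3 : t.arity = 1 ∨ t.arity = 2 := by omega
      · obtain ⟨a, ha⟩ := ih.2.1 (by omega) h3
        rw [← ha, h3]
        exact ⟨v ⊗ₜ a, quadTree₁_tmul v a⟩
      · obtain ⟨a, ha⟩ := ih.2.2.1 (by omega) h3
        rw [← ha, h3]
        exact ⟨(v ⊗ₜ a, 0, 0), quadTree₂_inl v a⟩
  · intro l r v x y ihl ihr
    have h1 := l.arity_le_degree
    have h2 := l.arity_pos
    have h1' := r.arity_le_degree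
    have h2' := r.arity_pos
    simp only [Shape.degree, Shape.arity]
    refine ⟨fun h => by omega, fun h _ => by omega, fun h _ => ?_, fun h => ?_⟩
    · obtain ⟨c, hc⟩ := Submodule.mem_span_singleton.1 (ihl.1 (by omega))
      obtain ⟨c', hc'⟩ := Submodule.mem_span_singleton.1 (ihr.1 (by omega))
      rw [← hc, ← hc']
      exact ⟨c' • c • v, by simp [corolla₂]⟩
    -- The second vertex lies in only one of the two subtrees; the other is a multiple of the
    -- identity, whose scalar is moved into the root decoration.
    · obtain h3 | h3 : l.degree 1 1 = 0 ∨ r.degree 1 1 = 0 := by omega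
      · obtain ⟨c, hc⟩ := Submodule.mem_span_singleton.1 (ihl.1 h3)
        obtain h4 | h4 : r.arity = 1 ∨ r.arity = 2 := by omega
        · obtain ⟨a, ha⟩ := ihr.2.1 (by omega) h4
          rw [← ha, ← hc, show l.arity + r.arity = 2 by omega]
          refine ⟨(0, 0, (c • v) ⊗ₜ a), ?_⟩
          rw [quadTree₂_inr]
          simp [corolla₁]
        · obtain ⟨a, ha⟩ := ihr.2.2.1 (by omega) h4
          rw [← ha, ← hc, show l.arity + r.arity = 3 by omega]
          refine ⟨(0, (c • v) ⊗ₜ a), ?_⟩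
          rw [quadTree₃_inr]
          simp [corolla₂]
      · obtain ⟨c, hc⟩ := Submodule.mem_span_singleton.1 (ihr.1 h3)
        obtain h4 | h4 : l.arity = 1 ∨ l.arity = 2 := by omega
        · obtain ⟨a, ha⟩ := ihl.2.1 (by omega) h4
          rw [← ha, ← hc, show l.arity + r.arity = 2 by omega]
          refine ⟨(0, (c • v) ⊗ₜ a, 0), ?_⟩
          rw [quadTree₂_mid]
          simp [corolla₁]
        · obtain ⟨a, ha⟩ := ihl.2.2.1 (by omega) h4
          rw [← ha, ← hc, show l.arity + r.arity = 3 by omega]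
          refine ⟨((c • v) ⊗ₜ a, 0), ?_⟩
          rw [quadTree₃_inl]
          simp [corolla₂]

theorem piece_two_le_quadRange (n : ℕ) : piece k 1 1 n 2 ≤ quadRange k E₁ E₂ n := fun X hX =>
  piece_induction (p := fun X => X ∈ quadRange k E₁ E₂ n) (zero_mem _) (fun _ _ => add_mem)
    (fun s x hn hd => by rw [← hn]; exact (ofShape_mem_of_degree_le_two s x).2.2.2 hd) hX

theorem QuadraticData.pairing_perp_relations (P : QuadraticData k E₁ E₂) (n : ℕ)
    {X : Tree k (Module.Dual k E₁) (Module.Dual k E₂)} (hX : X ∈ P.perp.relations n)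
    {Y : Tree k E₁ E₂} (hY : Y ∈ P.relations n) : pairing k X Y = 0 := by
  match n with
  | 1 =>
    obtain ⟨a, ha, rfl⟩ := hX
    obtain ⟨b, hb, rfl⟩ := hY
    rw [pairing_quadTree₁, ha b hb, neg_zero]
  | 2 =>
    obtain ⟨a, ha, rfl⟩ := hX
    obtain ⟨b, hb, rfl⟩ := hY
    rw [pairing_quadTree₂, ha b hb]
  | 3 =>
    obtain ⟨a, ha, rfl⟩ := hX
    obtain ⟨b, hb, rfl⟩ := hY
    rw [pairing_quadTree₃, ha b hb, neg_zero]
  | 0 => rw [(Submodule.mem_bot k).1 hY, map_zero]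
  | n + 4 => rw [(Submodule.mem_bot k).1 hY, map_zero]

variable [FiniteDimensional k E₁] [FiniteDimensional k E₂]

/-- Biduality `R^⊥⊥ = R`: every functional vanishing on `R` is represented by an element of `R^⊥`,
since the form is perfect. -/
theorem QuadraticData.mem_relations_of_perp (P : QuadraticData k E₁ E₂) (n : ℕ)
    {Y : Tree k E₁ E₂} (hY : Y ∈ quadRange k E₁ E₂ n)
    (h : ∀ X ∈ P.perp.relations n, pairing k X Y = 0) : Y ∈ P.relations n := by
  match n with
  | 1 =>
    obtain ⟨r, rfl⟩ := hY
    refine ⟨r, ?_, rfl⟩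
    refine (Subspace.forall_mem_dualAnnihilator_apply_eq_zero_iff P.R₁ r).1 fun φ hφ => ?_
    obtain ⟨X, rfl⟩ := (dualDistrib_bijective E₁ E₁).2 φ
    have h1 := h (quadTree₁ k X) ⟨X, (Submodule.mem_dualAnnihilator _).1 hφ, rfl⟩
    rwa [pairing_quadTree₁, neg_eq_zero] at h1
  | 2 =>
    obtain ⟨r, rfl⟩ := hY
    refine ⟨r, ?_, rfl⟩
    refine (Subspace.forall_mem_dualAnnihilator_apply_eq_zero_iff P.R₂ r).1 fun φ hφ => ?_
    -- The minus sign compensates the one of the form on the summand of the `α ∘₁ μ`.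
    obtain ⟨a, ha⟩ := (dualDistrib_bijective E₁ E₂).2 (-(φ ∘ₗ LinearMap.inl k _ _))
    obtain ⟨b, hb⟩ := (dualDistrib_bijective E₂ E₁).2
      (φ ∘ₗ LinearMap.inr k _ _ ∘ₗ LinearMap.inl k _ _)
    obtain ⟨c, hc⟩ := (dualDistrib_bijective E₂ E₁).2
      (φ ∘ₗ LinearMap.inr k _ _ ∘ₗ LinearMap.inr k _ _)
    have h0 : ∀ r : Quad₂ k E₁ E₂, - TensorProduct.dualDistrib k E₁ E₂ a r.1
        + TensorProduct.dualDistrib k E₂ E₁ b r.2.1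
        + TensorProduct.dualDistrib k E₂ E₁ c r.2.2 = φ r := fun r => by
      rw [ha, hb, hc]
      simp only [LinearMap.neg_apply, neg_neg, LinearMap.comp_apply, LinearMap.inl_apply,
        LinearMap.inr_apply, ← map_add]
      simp
    have h1 := h (quadTree₂ k (a, b, c)) ⟨(a, b, c),
      fun r hr => (h0 r).trans ((Submodule.mem_dualAnnihilator _).1 hφ r hr), rfl⟩
    rwa [pairing_quadTree₂, h0] at h1
  | 3 =>
    obtain ⟨r, rfl⟩ := hY
    refine ⟨r, ?_, rfl⟩
    refine (Subspace.forall_mem_dualAnnihilator_apply_eq_zero_iff P.R₃ r).1 fun φ hφ => ?_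
    obtain ⟨a, ha⟩ := (dualDistrib_bijective E₂ E₂).2 (φ ∘ₗ LinearMap.inl k _ _)
    obtain ⟨b, hb⟩ := (dualDistrib_bijective E₂ E₂).2 (-(φ ∘ₗ LinearMap.inr k _ _))
    have h0 : ∀ r : Quad₃ k E₂, TensorProduct.dualDistrib k E₂ E₂ a r.1
        - TensorProduct.dualDistrib k E₂ E₂ b r.2 = φ r := fun r => by
      rw [ha, hb]
      simp only [LinearMap.neg_apply, sub_neg_eq_add, LinearMap.comp_apply, LinearMap.inl_apply,
        LinearMap.inr_apply, ← map_add]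
      simp
    have h1 := h (quadTree₃ k (a, b)) ⟨(a, b),
      fun r hr => (h0 r).trans ((Submodule.mem_dualAnnihilator _).1 hφ r hr), rfl⟩
    rwa [pairing_quadTree₃, h0, neg_eq_zero] at h1
  | 0 => exact hY
  | n + 4 => exact hY

end Relations

/-! ### Orthogonality between ideals and sub-cooperads -/

section Duality

variable {k : Type u} [Field k]

theorem dualDistrib_mapIncl {V W : Type u} [AddCommGroup V] [Module k V] [AddCommGroup W]
    [Module k W] (K : Submodule k V) (L : Submodule k W) (f : Module.Dual k V)
    (g : Module.Dual k W) (z : K ⊗[k] L) :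
    TensorProduct.dualDistrib k V W (f ⊗ₜ g) (TensorProduct.mapIncl K L z) =
      TensorProduct.dualDistrib k K L ((f ∘ₗ K.subtype) ⊗ₜ (g ∘ₗ L.subtype)) z := by
  induction z with
  | zero => simp
  | add a b ha hb => rw [map_add, map_add, map_add, ha, hb]
  | tmul a b => simp [TensorProduct.mapIncl]

theorem CooperadData.mapIncl_sub_decomp (C : CooperadData k)
    (K : ∀ n d, Submodule k (C.obj n d)) (hK : C.IsSubcooperad K) {m n N : ℕ} {d e D : ℤ} (i : ℕ)
    (hi : 1 ≤ i ∧ i ≤ m) (hN : N + 1 = m + n) (hD : d + e = D) (z : K N D) :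
    TensorProduct.mapIncl (K m d) (K n e) ((C.sub K hK).decomp i hi hN hD z) =
      C.decomp i hi hN hD z.1 :=
  congrArg Subtype.val ((LinearEquiv.ofInjective (TensorProduct.mapIncl (K m d) (K n e))
    (mapIncl_injective _ _)).apply_symm_apply ⟨C.decomp i hi hN hD z.1, hK i hi hN hD z.1 z.2⟩)

/-- The composition in the dual of a sub-cooperad can be computed in the ambient cooperad with any
extensions of the functionals. -/
theorem CooperadData.dualDistrib_sub_decomp (C : CooperadData k)
    (K : ∀ n d, Submodule k (C.obj n d)) (hK : C.IsSubcooperad K) {m n N : ℕ} {d e D : ℤ} (i : ℕ)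
    (hi : 1 ≤ i ∧ i ≤ m) (hN : N + 1 = m + n) (hD : d + e = D) (f : Module.Dual k (C.obj m d))
    (g : Module.Dual k (C.obj n e)) (z : K N D) :
    TensorProduct.dualDistrib k _ _ (f ⊗ₜ g) (C.decomp i hi hN hD z.1) =
      TensorProduct.dualDistrib k (K m d) (K n e) ((f ∘ₗ (K m d).subtype) ⊗ₜ (g ∘ₗ (K n e).subtype))
        ((C.sub K hK).decomp i hi hN hD z) :=
  (congrArg _ (C.mapIncl_sub_decomp K hK i hi hN hD z)).symm.trans (dualDistrib_mapIncl _ _ f g _)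

theorem CooperadData.largest_le (C : CooperadData k) (S : ∀ n d, Submodule k (C.obj n d))
    (n : ℕ) (d : ℤ) : C.largest S n d ≤ S n d :=
  iSup_le fun K => K.2.2 n d

theorem CooperadData.le_largest (C : CooperadData k) (S K : ∀ n d, Submodule k (C.obj n d))
    (hK : C.IsSubcooperad K) (hS : ∀ n d, K n d ≤ S n d) (n : ℕ) (d : ℤ) :
    K n d ≤ C.largest S n d :=
  le_iSup (fun K : {K : ∀ n d, Submodule k (C.obj n d) //
      C.IsSubcooperad K ∧ ∀ n d, K n d ≤ S n d} => K.1 n d) ⟨K, hK, hS⟩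

theorem OperadData.le_ideal (O : OperadData k) (S : ∀ n d, Submodule k (O.obj n d)) (n : ℕ)
    (d : ℤ) : S n d ≤ O.ideal S n d :=
  le_iInf fun I => I.2.2 n d

theorem OperadData.ideal_le (O : OperadData k) (S I : ∀ n d, Submodule k (O.obj n d))
    (hI : O.IsIdeal I) (hS : ∀ n d, S n d ≤ I n d) (n : ℕ) (d : ℤ) : O.ideal S n d ≤ I n d :=
  iInf_le (fun I : {I : ∀ n d, Submodule k (O.obj n d) // O.IsIdeal I ∧ ∀ n d, S n d ≤ I n d} =>
    I.1 n d) ⟨I, hI, hS⟩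

variable {E₁ E₂ : Type u} [AddCommGroup E₁] [Module k E₁] [AddCommGroup E₂] [Module k E₂]

/-- Homogeneous `X` and `Y` see only the components of matching arity and weight, so the projections
in the decomposition of `cofree` change nothing. -/
theorem pairing₂_eq_dualDistrib {m n : ℕ} {d e : ℤ}
    (X : piece k (E₁ := Module.Dual k E₁) (E₂ := Module.Dual k E₂) (-1) 0 m d)
    (Y : piece k (E₁ := Module.Dual k E₁) (E₂ := Module.Dual k E₂) (-1) 0 n e)
    (W : Tree k E₁ E₂ ⊗[k] Tree k E₁ E₂) :
    pairing₂ X.1 Y.1 W = TensorProduct.dualDistrib k _ _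
      (piecePairing m d (-d + (m : ℤ) - 1) X ⊗ₜ piecePairing n e (-e + (n : ℤ) - 1) Y)
      (TensorProduct.map (proj k 1 1 m (-d + (m : ℤ) - 1)) (proj k 1 1 n (-e + (n : ℤ) - 1)) W) := by
  induction W with
  | zero => simp
  | add a b ha hb => rw [map_add, map_add, map_add, ha, hb]
  | tmul a b =>
    rw [TensorProduct.map_tmul, TensorProduct.dualDistrib_apply, TensorProduct.dualDistrib_apply,
      piecePairing_apply, piecePairing_apply, pairing_proj X.2 rfl, pairing_proj Y.2 rfl]

/-- The pairing as a map from `𝒯(E*)` to the dual of `𝒯ᶜ(sE)`. -/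
def dualityMap (n : ℕ) (d w : ℤ) :
    (free k (Module.Dual k E₁) (Module.Dual k E₂) (-1) 0).obj n d →ₗ[k]
      Module.Dual k ((cofree k E₁ E₂ 1 1).obj n w) :=
  piecePairing n d w

theorem pairing_circ {m n N : ℕ} {d e D : ℤ} (i : ℕ) (hi : 1 ≤ i ∧ i ≤ m) (hN : N + 1 = m + n)
    (hD : d + e = D) (hD' : -d + (m : ℤ) - 1 + (-e + (n : ℤ) - 1) = -D + (N : ℤ) - 1)
    (X : (free k (Module.Dual k E₁) (Module.Dual k E₂) (-1) 0).obj m d)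
    (Y : (free k (Module.Dual k E₁) (Module.Dual k E₂) (-1) 0).obj n e)
    (Z : (cofree k E₁ E₂ 1 1).obj N (-D + (N : ℤ) - 1)) :
    dualityMap N D (-D + (N : ℤ) - 1)
      ((free k (Module.Dual k E₁) (Module.Dual k E₂) (-1) 0).circ i hi hN hD X Y) Z =
      circSgn k m n d e i * TensorProduct.dualDistrib k _ _
        (dualityMap m d (-d + (m : ℤ) - 1) X ⊗ₜ dualityMap n e (-e + (n : ℤ) - 1) Y)
        ((cofree k E₁ E₂ 1 1).decomp i hi hN hD' Z) :=
  (pairing_graft X.2 Y.2 i hi.1 Z.1).trans (congrArg _ (pairing₂_eq_dualDistrib X Y _))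

theorem circSgn_ne_zero (m n : ℕ) (d e : ℤ) (i : ℕ) : circSgn k m n d e i ≠ 0 := by
  rw [circSgn, ← sgn_add, ← sgn_add]
  exact left_ne_zero_of_mul_eq_one (sgn_mul_self k _)

/-- The subspaces of `𝒯(E*)` orthogonal to a family of subspaces of `𝒯ᶜ(sE)`. -/
def orthogonal (K : ∀ n d, Submodule k ((cofree k E₁ E₂ 1 1).obj n d)) (n : ℕ) (d : ℤ) :
    Submodule k ((free k (Module.Dual k E₁) (Module.Dual k E₂) (-1) 0).obj n d) :=
  (K n (-d + (n : ℤ) - 1)).dualAnnihilator.comap (dualityMap n d (-d + (n : ℤ) - 1))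

theorem mem_orthogonal {K : ∀ n d, Submodule k ((cofree k E₁ E₂ 1 1).obj n d)} {n : ℕ} {d : ℤ}
    {X : (free k (Module.Dual k E₁) (Module.Dual k E₂) (-1) 0).obj n d} :
    X ∈ orthogonal K n d ↔
      ∀ Y ∈ K n (-d + (n : ℤ) - 1), dualityMap n d (-d + (n : ℤ) - 1) X Y = 0 :=
  Submodule.mem_dualAnnihilator _

/-- By adjunction, a composite is evaluated on `K` through the decomposition, which lies in `K ⊗ K`;
one factor vanishing on `K` suffices. -/
theorem isIdeal_orthogonal {K : ∀ n d, Submodule k ((cofree k E₁ E₂ 1 1).obj n d)}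
    (hK : (cofree k E₁ E₂ 1 1).IsSubcooperad K) :
    (free k (Module.Dual k E₁) (Module.Dual k E₂) (-1) 0).IsIdeal (orthogonal K) where
  left {m n N d e D} i hi hN hD X hX Y := by
    refine mem_orthogonal.2 fun Z hZ => ?_
    have hD' : -d + (m : ℤ) - 1 + (-e + (n : ℤ) - 1) = -D + (N : ℤ) - 1 := by omega
    rw [pairing_circ i hi hN hD hD']
    obtain ⟨w, hw⟩ := hK i hi hN hD' Z hZ
    rw [← hw, dualDistrib_mapIncl, show dualityMap m d (-d + (m : ℤ) - 1) X ∘ₗ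
      (K m (-d + (m : ℤ) - 1)).subtype = 0 from
        LinearMap.ext fun z => mem_orthogonal.1 hX z.1 z.2]
    simp
  right {m n N d e D} i hi hN hD X Y hY := by
    refine mem_orthogonal.2 fun Z hZ => ?_
    have hD' : -d + (m : ℤ) - 1 + (-e + (n : ℤ) - 1) = -D + (N : ℤ) - 1 := by omega
    rw [pairing_circ i hi hN hD hD']
    obtain ⟨w, hw⟩ := hK i hi hN hD' Z hZ
    rw [← hw, dualDistrib_mapIncl, show dualityMap n e (-e + (n : ℤ) - 1) Y ∘ₗ
      (K n (-e + (n : ℤ) - 1)).subtype = 0 from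
        LinearMap.ext fun z => mem_orthogonal.1 hY z.1 z.2]
    simp

/-- The subspaces of `𝒯ᶜ(sE)` orthogonal to a family of subspaces of `𝒯(E*)`. -/
def coorthogonal
    (I : ∀ n d, Submodule k ((free k (Module.Dual k E₁) (Module.Dual k E₂) (-1) 0).obj n d))
    (n : ℕ) (w : ℤ) : Submodule k ((cofree k E₁ E₂ 1 1).obj n w) :=
  ((I n ((n : ℤ) - 1 - w)).map (dualityMap n ((n : ℤ) - 1 - w) w)).dualCoannihilator

/-- The degree `n - 1 - w` equals `d` only propositionally for `w = -d + n - 1`, so the spaces are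
transported along this equality. -/
theorem coorthogonal_eq
    (I : ∀ n d, Submodule k ((free k (Module.Dual k E₁) (Module.Dual k E₂) (-1) 0).obj n d))
    (n : ℕ) (d : ℤ) : coorthogonal I n (-d + (n : ℤ) - 1) =
      ((I n d).map (dualityMap n d (-d + (n : ℤ) - 1))).dualCoannihilator := by
  have h : ∀ d', d' = d → ((I n d').map
      (dualityMap n d' (-d + (n : ℤ) - 1))).dualCoannihilator =
      ((I n d).map (dualityMap n d (-d + (n : ℤ) - 1))).dualCoannihilator := by
    rintro _ rfl
    rfl
  exact h _ (by omega)

theorem mem_coorthogonal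
    {I : ∀ n d, Submodule k ((free k (Module.Dual k E₁) (Module.Dual k E₂) (-1) 0).obj n d)}
    {n : ℕ} {d : ℤ} {Y : (cofree k E₁ E₂ 1 1).obj n (-d + (n : ℤ) - 1)} :
    Y ∈ coorthogonal I n (-d + (n : ℤ) - 1) ↔
      ∀ X ∈ I n d, dualityMap n d (-d + (n : ℤ) - 1) X Y = 0 := by
  rw [coorthogonal_eq, Submodule.mem_dualCoannihilator]
  exact ⟨fun h X hX => h _ ⟨X, hX, rfl⟩, by rintro h _ ⟨X, hX, rfl⟩; exact h X hX⟩

theorem pairing_leafT (Z : Tree k E₁ E₂) :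
    pairing k (leafT k) Z = decLeaf k E₁ E₂ (Z .leaf) := by
  rw [leafT, pairing_ofShape, shapePairing]
  simp

theorem pairing_corolla₁ (f : Module.Dual k E₁) (Z : Tree k E₁ E₂) :
    pairing k (corolla₁ k f) Z = f (TensorProduct.rid k E₁ (TensorProduct.map LinearMap.id
      (decLeaf k E₁ E₂).toLinearMap (decUn k E₁ E₂ .leaf (Z (.un .leaf))))) := by
  rw [corolla₁, LinearMap.flip_apply, leafT, unT_ofShape, pairing_ofShape, shapePairing]
  generalize hw : decUn k E₁ E₂ .leaf (Z (.un .leaf)) = w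
  simp only [LinearMap.smul_apply, LinearMap.comp_apply, LinearEquiv.coe_coe,
    LinearEquiv.apply_symm_apply, LinearMap.dualMap_apply, hw]
  clear hw
  induction w with
  | zero => simp
  | add a b ha hb => simp only [map_add, ← ha, ← hb, smul_add]
  | tmul a b => simp [shapePairing, Shape.degree, sgn_zero, mul_comm]

theorem pairing_corolla₂ (f : Module.Dual k E₂) (Z : Tree k E₁ E₂) :
    pairing k (corolla₂ k f) Z = f (TensorProduct.rid k E₂ (TensorProduct.map LinearMap.id
      ((TensorProduct.rid k k).toLinearMap ∘ₗ
        TensorProduct.map (decLeaf k E₁ E₂).toLinearMap (decLeaf k E₁ E₂).toLinearMap)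
      (decBin k E₁ E₂ .leaf .leaf (Z (.bin .leaf .leaf))))) := by
  rw [corolla₂, LinearMap.flip_apply, LinearMap.flip_apply, leafT, binT_ofShape, pairing_ofShape,
    shapePairing]
  generalize hw : decBin k E₁ E₂ .leaf .leaf (Z (.bin .leaf .leaf)) = w
  simp only [LinearMap.smul_apply, LinearMap.comp_apply, LinearEquiv.coe_coe,
    LinearEquiv.apply_symm_apply, LinearMap.dualMap_apply, hw]
  clear hw
  induction w with
  | zero => simp
  | add a b ha hb => simp only [map_add, ← ha, ← hb, smul_add]
  | tmul a b =>
    induction b with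
    | zero => simp
    | add b c hb hc => simp only [TensorProduct.tmul_add, map_add, ← hb, ← hc, smul_add]
    | tmul b c => simp [shapePairing, Shape.degree, Shape.arity, sgn_zero]; ring

/-- The map `𝒯(E*) → P^!`. -/
def QuadraticData.toKoszulDual (P : QuadraticData k E₁ E₂) (n : ℕ) (d : ℤ) :
    (free k (Module.Dual k E₁) (Module.Dual k E₂) (-1) 0).obj n d →ₗ[k] P.koszulDual.obj n d :=
  Submodule.dualRestrict ((cofree k E₁ E₂ 1 1).largest P.corelations n (-d + (n : ℤ) - 1)) ∘ₗ
    dualityMap n d (-d + (n : ℤ) - 1)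

theorem QuadraticData.toKoszulDual_one (P : QuadraticData k E₁ E₂) :
    P.toKoszulDual 1 0 (free k (Module.Dual k E₁) (Module.Dual k E₂) (-1) 0).one =
      P.koszulDual.one := by
  refine LinearMap.ext fun Z => ?_
  exact pairing_leafT Z.1.1

theorem QuadraticData.toKoszulDual_circ (P : QuadraticData k E₁ E₂) {m n N : ℕ} {d e D : ℤ}
    (i : ℕ) (hi : 1 ≤ i ∧ i ≤ m) (hN : N + 1 = m + n) (hD : d + e = D)
    (X : (free k (Module.Dual k E₁) (Module.Dual k E₂) (-1) 0).obj m d)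
    (Y : (free k (Module.Dual k E₁) (Module.Dual k E₂) (-1) 0).obj n e) :
    P.toKoszulDual N D
      ((free k (Module.Dual k E₁) (Module.Dual k E₂) (-1) 0).circ i hi hN hD X Y) =
      P.koszulDual.circ i hi hN hD (P.toKoszulDual m d X) (P.toKoszulDual n e Y) := by
  have hD' : -d + (m : ℤ) - 1 + (-e + (n : ℤ) - 1) = -D + (N : ℤ) - 1 := by omega
  refine LinearMap.ext fun Z => ?_
  refine (pairing_circ i hi hN hD hD' X Y Z.1).trans ?_
  have h := ((cofree k E₁ E₂ 1 1).dualDistrib_sub_decomp _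
    ((cofree k E₁ E₂ 1 1).isSubcooperad_largest P.corelations) i hi hN hD'
    (dualityMap m d (-d + (m : ℤ) - 1) X) (dualityMap n e (-e + (n : ℤ) - 1) Y) Z)
  refine (congrArg (circSgn k m n d e i * ·) h).trans ?_
  -- Splits `circSgn` as in the definition of `P^!`: the sign of the linear dual stands outside, the
  -- two signs of the suspension stand inside the decomposition.
  have h' : ∀ (φ : Module.Dual k (P.koszulDualCooperad.obj m (-d + (m : ℤ) - 1) ⊗[k]
      P.koszulDualCooperad.obj n (-e + (n : ℤ) - 1))) w, circSgn k m n d e i * φ w =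
      sgn k (e * -d) • φ ((sgn k (((i : ℤ) - 1) * (1 - (n : ℤ))) *
        sgn k ((1 - (n : ℤ)) * (-d + (m : ℤ) - 1))) • w) := fun φ w => by
    rw [map_smul, smul_eq_mul, smul_eq_mul, circSgn, mul_assoc]
  exact h' _ _

variable [FiniteDimensional k E₁] [FiniteDimensional k E₂]

instance finiteDimensional_cofree (n : ℕ) (w : ℤ) :
    FiniteDimensional k ((cofree k E₁ E₂ 1 1).obj n w) :=
  finiteDimensional_piece n w

theorem dualityMap_injective (n : ℕ) (d : ℤ) :
    Function.Injective (dualityMap (k := k) (E₁ := E₁) (E₂ := E₂) n d (-d + (n : ℤ) - 1)) :=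
  piecePairing_injective n d

theorem dualityMap_surjective (n : ℕ) (d : ℤ) :
    Function.Surjective (dualityMap (k := k) (E₁ := E₁) (E₂ := E₂) n d (-d + (n : ℤ) - 1)) :=
  piecePairing_surjective n d

/-- Every subspace of the dual of a finite-dimensional space is the annihilator of its common zeros.
-/
theorem dualAnnihilator_coorthogonal
    (I : ∀ n d, Submodule k ((free k (Module.Dual k E₁) (Module.Dual k E₂) (-1) 0).obj n d))
    (n : ℕ) (d : ℤ) : (coorthogonal I n (-d + (n : ℤ) - 1)).dualAnnihilator =
      (I n d).map (dualityMap (E₁ := E₁) (E₂ := E₂) n d (-d + (n : ℤ) - 1)) := by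
  rw [coorthogonal_eq]
  exact Subspace.dualCoannihilator_dualAnnihilator_eq

theorem orthogonal_coorthogonal
    (I : ∀ n d, Submodule k ((free k (Module.Dual k E₁) (Module.Dual k E₂) (-1) 0).obj n d))
    (n : ℕ) (d : ℤ) : orthogonal (coorthogonal (E₁ := E₁) (E₂ := E₂) I) n d = I n d := by
  rw [orthogonal, dualAnnihilator_coorthogonal]
  exact Submodule.comap_map_eq_of_injective (dualityMap_injective n d) _

/-- By perfectness all functionals come from `𝒯(E*)`, and those vanishing on the coorthogonal come
from `I`. A composite with one factor in `I` is in `I`, so by adjunction it yields the vanishing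
required by `mem_range_mapIncl`. -/
theorem isSubcooperad_coorthogonal
    {I : ∀ n d, Submodule k ((free k (Module.Dual k E₁) (Module.Dual k E₂) (-1) 0).obj n d)}
    (hI : (free k (Module.Dual k E₁) (Module.Dual k E₂) (-1) 0).IsIdeal I) :
    (cofree k E₁ E₂ 1 1).IsSubcooperad (coorthogonal I) := by
  intro m n N d e D i hi hN hD Z hZ
  -- Weights are rewritten in terms of the corresponding degrees of `𝒯(E*)`.
  obtain ⟨d, rfl⟩ : ∃ d', d = -d' + (m : ℤ) - 1 := ⟨-d + m - 1, by omega⟩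
  obtain ⟨e, rfl⟩ : ∃ e', e = -e' + (n : ℤ) - 1 := ⟨-e + n - 1, by omega⟩
  obtain ⟨D, rfl⟩ : ∃ D', D = -D' + (N : ℤ) - 1 := ⟨-D + N - 1, by omega⟩
  have hD' : d + e = D := by omega
  have key : ∀ X Y, (free k (Module.Dual k E₁) (Module.Dual k E₂) (-1) 0).circ i hi hN hD' X Y ∈
      I N D → TensorProduct.dualDistrib k _ _
        (dualityMap m d (-d + (m : ℤ) - 1) X ⊗ₜ dualityMap n e (-e + (n : ℤ) - 1) Y)
        ((cofree k E₁ E₂ 1 1).decomp i hi hN hD Z) = 0 := fun X Y hXY => by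
    have h := mem_coorthogonal.1 hZ _ hXY
    rw [pairing_circ i hi hN hD' hD] at h
    exact (mul_eq_zero.1 h).resolve_left (circSgn_ne_zero _ _ _ _ _)
  refine mem_range_mapIncl _ _ _ ?_ ?_
  · intro f hf g
    rw [dualAnnihilator_coorthogonal] at hf
    obtain ⟨X, hX, rfl⟩ := hf
    obtain ⟨Y, rfl⟩ := dualityMap_surjective n e g
    exact key X Y (hI.left i hi hN hD' X hX Y)
  · intro f g hg
    rw [dualAnnihilator_coorthogonal] at hg
    obtain ⟨Y, hY, rfl⟩ := hg
    obtain ⟨X, rfl⟩ := dualityMap_surjective m d f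
    exact key X Y (hI.right i hi hN hD' X Y hY)

/-- The ideal generated by `R^⊥` is orthogonal to the Koszul dual cooperad. -/
theorem QuadraticData.orthogonal_largest (P : QuadraticData k E₁ E₂) (n : ℕ) (d : ℤ) :
    orthogonal ((cofree k E₁ E₂ 1 1).largest P.corelations) n d =
      (free k (Module.Dual k E₁) (Module.Dual k E₂) (-1) 0).ideal
        (fun n d => (P.perp.relations n).comap (piece k (-1) 0 n d).subtype) n d := by
  apply le_antisymm
  -- Biduality turns the inclusion into one of sub-cooperads: the coorthogonal of the ideal is a
  -- sub-cooperad satisfying the corelations, hence lies in the largest one.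
  · rw [← orthogonal_coorthogonal (E₁ := E₁) (E₂ := E₂)
      ((free k (Module.Dual k E₁) (Module.Dual k E₂) (-1) 0).ideal
        (fun n d => (P.perp.relations n).comap (piece k (-1) 0 n d).subtype)) n d]
    refine Submodule.comap_mono (Submodule.dualAnnihilator_anti ?_)
    refine CooperadData.le_largest _ _ _
      (isSubcooperad_coorthogonal (OperadData.isIdeal_ideal _ _)) (fun n w Y hY => ?_) _ _
    rw [QuadraticData.corelations]
    split_ifs with hw
    · obtain ⟨d, rfl, hd⟩ : ∃ d', w = -d' + (n : ℤ) - 1 ∧ d' = (n : ℤ) - 3 :=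
        ⟨(n : ℤ) - 3, by omega, rfl⟩
      subst hd
      refine P.mem_relations_of_perp n (piece_two_le_quadRange n (hw ▸ Y.2)) fun X hX => ?_
      exact mem_coorthogonal.1 hY ⟨X, P.perp.relations_le_piece n hX⟩ (OperadData.le_ideal _ _ _ _ hX)
    · exact Submodule.mem_top
  · refine OperadData.ideal_le _ _ _
      (isIdeal_orthogonal (CooperadData.isSubcooperad_largest _ _)) (fun n d X hX => ?_) n d
    refine mem_orthogonal.2 fun Y hY => ?_
    have hY' := CooperadData.largest_le _ _ _ _ hY
    rw [QuadraticData.corelations] at hY'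
    split_ifs at hY' with hw
    · exact P.pairing_perp_relations n hX hY'
    -- Outside weight two the corelations impose nothing, but `R^⊥` sits in degree `n - 3` and is
    -- orthogonal to all other weights.
    · exact pairing_eq_zero (P.perp.relations_le_piece n hX) Y.2 (by omega)

theorem QuadraticData.toKoszulDual_surjective (P : QuadraticData k E₁ E₂) (n : ℕ) (d : ℤ) :
    Function.Surjective (P.toKoszulDual n d) :=
  Subspace.dualRestrict_surjective.comp (dualityMap_surjective n d)

/-- The kernel of restricting functionals to `P^¡` is its annihilator, so this kernel is the
orthogonal of `P^¡` by definition. -/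
theorem QuadraticData.ker_toKoszulDual (P : QuadraticData k E₁ E₂) (n : ℕ) (d : ℤ) :
    (free k (Module.Dual k E₁) (Module.Dual k E₂) (-1) 0).ideal
      (fun n d => (P.perp.relations n).comap (piece k (-1) 0 n d).subtype) n d =
    LinearMap.ker (P.toKoszulDual n d) :=
  (P.orthogonal_largest n d).symm

/-- The isomorphism `𝒯(E*)/⟨R^⊥⟩ ≅ P^!` in arity `n` and degree `d`. -/
def QuadraticData.koszulDualEquiv (P : QuadraticData k E₁ E₂) (n : ℕ) (d : ℤ) :
    (P.perp.operad (-1) 0).obj n d ≃ₗ[k] P.koszulDual.obj n d :=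
  (Submodule.quotEquivOfEq _ _ (P.ker_toKoszulDual n d)).trans
    ((P.toKoszulDual n d).quotKerEquivOfSurjective (P.toKoszulDual_surjective n d))

end Duality

end UnaryBinary

end

/-! ### The isomorphism of operads -/

theorem mainTheorem4 {k : Type u} [Field k] [CharZero k]
    {E₁ E₂ : Type u} [AddCommGroup E₁] [Module k E₁] [FiniteDimensional k E₁]
    [AddCommGroup E₂] [Module k E₂] [FiniteDimensional k E₂]
    (P : UnaryBinary.QuadraticData k E₁ E₂) :
    ∃ φ : UnaryBinary.OperadIso (P.perp.operad (-1) 0).toOperadData P.koszulDual,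
      (∀ f : Module.Dual k E₁, φ.map 1 (-1) (P.perp.gen₁ (-1) 0 f) = P.cogen₁ f) ∧
      (∀ f : Module.Dual k E₂, φ.map 2 0 (P.perp.gen₂ (-1) 0 f) = P.cogen₂ f) := by
  refine ⟨⟨P.koszulDualEquiv, P.toKoszulDual_one, fun {m n N d e D} i hi hN hD x y => ?_⟩,
    fun f => ?_, fun f => ?_⟩
  -- On representatives, the composition of the quotient is that of `𝒯(E*)` and the isomorphism is
  -- `toKoszulDual`.
  · obtain ⟨X, rfl⟩ := Submodule.mkQ_surjective _ x
    obtain ⟨Y, rfl⟩ := Submodule.mkQ_surjective _ y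
    exact P.toKoszulDual_circ i hi hN hD X Y
  · exact LinearMap.ext fun Z => UnaryBinary.pairing_corolla₁ f Z.1.1
  · exact LinearMap.ext fun Z => UnaryBinary.pairing_corolla₂ f Z.1.1
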